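/- **Setting.** Let $\mathcal X$ be an input space, $\mathcal Y$ an output space, and $\mathcal D$ a distribution over $\mathcal X\times\mathcal Y$. For each input $x$ let $\mathcal Y(x)\subseteq\mathcal Y$ be the set of outputs available for $x$ (in the simplest case $\mathcal Y(x)=\mathcal Y$; if the size of the examples varies, the outputs of the size of $x$), and assume $y\in\mathcal Y(x)$ for $\mathcal D$-almost every $(x,y)$. Let $\ell\colon\mathcal Y\times\mathcal Y\to[0,\infty)$ be a bounded loss that is definite, i.e. $\ell(y,y')=0$ iff $y=y'$, and let $M=\sup_{y,y'}\ell(y,y')$. To every example $z=(x,y)$ is attached a factor graph $G(z)=([l_z],F_z,E_z)$ with variable nodes $1,\dots,l_z$, a finite set $F_z$ of factor nodes and a set $E_z$ of edges between factor and variable nodes. Each output $y'\in\mathcal Y(x)$ has substructures $y'_k\in\mathcal Y_k$, $k\in[l_z]$; for $f\in F_z$, let $y'_f$ be the tuple of the $y'_k$ for the $k$ connected to $f$, which lies in the product $\mathcal Y_f$ of the corresponding label sets, assumed finite. Let $\mathcal H$ be a family of scoring functions $h\colon\mathcal X\times\mathcal Y\to\mathbb R$, each given with a decomposition $$h(x,y')=\sum_{f\in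 F_z}h_f(x,y'_f)\qquad\text{for all examples } z=(x,y) \text{ with } y\in\mathcal Y(x) \text{ and all } y'\in\mathcal Y(x).$$ Let $\mathsf h(x)\in\operatorname{argmax}_{y\in\mathcal Y(x)}h(x,y)$ be the predictor defined by $h$ (ties broken arbitrarily), and $R(h)=\mathbb E_{(x,y)\sim\mathcal D}[\ell(\mathsf h(x),y)]$ its generalization error. Put $\Phi(r)=\min(M,\max(0,r))$ and, for $\rho>0$, $$L^{\rm add}_{\rho,h}(x,y)=\Phi\Big(\max_{y'\ne y}\ \ell(y',y)-\tfrac1\rho\,[h(x,y)-h(x,y')]\Big),\qquad L^{\rm mult}_{\rho,h}(x,y)=\Phi\Big(\max_{y'\neq y}\ \ell(y',y)\big(1-\tfrac1\rho\,[h(x,y)-h(x,y')]\big)\Big),$$ where $y'$ ranges over $\mathcal Y(x)\setminus\{y\}$, the maximum being a supremum if it is not attained (and the value of both losses being $0$ if this set is empty). Let $R^{\rm add}_\rho(h)$, $R^{\rm mult}_\rho(h)$ be the expectations of these losses under $\mathcal D$, and $\widehat R^{\rm add}_{S,\rho}(h)$, $\widehat R^{\rm mult}_{S,\rho}(h)$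 their averages over a sample $S=((x_1,y_1),\dots,(x_m,y_m))$. With $F_i=F_{(x_i,y_i)}$, the empirical factor graph Rademacher complexity of $\mathcal H$ is $$\widehat{\mathfrak R}^G_S(\mathcal H)=\frac1m\,\mathbb E_{\epsilon}\Big[\sup_{h\in\mathcal H}\sum_{i=1}^m\sum_{f\in F_i}\sum_{y\in\mathcal Y_f}\sqrt{|F_i|}\;\epsilon_{i,f,y}\,h_f(x_i,y)\Big]\in(-\infty,+\infty]$$ (for $\mathcal H\neq\emptyset$), with independent $\epsilon_{i,f,y}$ uniformly distributed over $\{\pm1\}$. The functions $(x,y)\mapsto\ell(\mathsf h(x),y)$, $L^{\rm add}_{\rho,h}$, $L^{\rm mult}_{\rho,h}$, and the suprema over $h\in\mathcal H$ of finite weighted sums $\sum_i a_iL_{\rho,h}(z_i)$ of either of these two margin losses, as functions of $(z_1,\dots,z_n)$, are assumed to be measurable (up to null sets). **Theorem.** Fix $\rho>0$ and $m\ge1$. For any $\delta>0$, with probability at least $1-\delta$ over the draw of an i.i.d. sample $S\sim\mathcal D^m$, the following holds for all $h\in\mathcal H$: $$R(h)\le R^{\rm add}_\rho(h)\le\widehat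 R^{\rm add}_{S,\rho}(h)+\frac{4\sqrt2}{\rho}\,\widehat{\mathfrak R}^G_S(\mathcal H)+3M\sqrt{\frac{\log\frac1\delta}{2m}};$$ and likewise, with probability at least $1-\delta$, the following holds for all $h\in\mathcal H$: $$R(h)\le R^{\rm mult}_\rho(h)\le\widehat R^{\rm mult}_{S,\rho}(h)+\frac{4\sqrt2\,M}{\rho}\,\widehat{\mathfrak R}^G_S(\mathcal H)+3M\sqrt{\frac{\log\frac1\delta}{2m}}.$$ (For $\delta>1$ the claims are void; the square root is then read as $0$.) -/

import Mathlib

open MeasureTheory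

noncomputable section

namespace StructPred

universe u v w

/-- A factor graph `([l], F, E)` over a set `O` of outputs: `size = l` variable nodes, the `k`-th one
carrying the set `Label k` of possible labels of the `k`-th substructure, a finite set `Factor` of
factor nodes, and edges between factor and variable nodes. `part y k` is the `k`-th substructure
`y_k` of the output `y`. The label set of every factor is finite. -/
structure FactorGraph (O : Type u) where
  size : ℕ
  Label : Fin size → Type v
  part : O → (k : Fin size) → Label k
  Factor : Type w
  [factorFintype : Fintype Factor]
  edge : Factor → Fin size → Prop
  [labelFintype : ∀ f, Fintype ((k : {k // edge f k}) → Label k.1)]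

attribute [instance] FactorGraph.factorFintype FactorGraph.labelFintype

/-- `𝒴_f`, the product of the label sets of the variable nodes connected to the factor `f`. -/
abbrev FactorGraph.LocalLabel {O : Type u} (G : FactorGraph.{u, v, w} O) (f : G.Factor) :
    Type v :=
  (k : {k // G.edge f k}) → G.Label k.1

/-- `y_f`, the restriction of the output `y` to the substructures connected to the factor `f`. -/
def FactorGraph.restrict {O : Type u} (G : FactorGraph.{u, v, w} O) (f : G.Factor) (y : O) :
    G.LocalLabel f :=
  fun k => G.part y k.1

variable {X Y : Type*}

/-- A scoring function `h` together with its decomposition along factor graphs. Outputs available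
for the input `x` are the elements of `outputs x` (all of `Y` in the simplest setting, the sequences
of the length of `x` when sizes vary), and the factor graph may depend on the example `z = (x, y)`.
`factor z f` is `h_f(x, ·)`. -/
structure Scoring (outputs : X → Set Y)
    (G : (z : X × Y) → FactorGraph.{_, v, w} (outputs z.1)) where
  score : X → Y → ℝ
  factor : (z : X × Y) → (f : (G z).Factor) → (G z).LocalLabel f → ℝ
  decomp : ∀ (x : X) (y : Y), y ∈ outputs x → ∀ y' : outputs x,
    score x y' = ∑ f : (G (x, y)).Factor, factor (x, y) f ((G (x, y)).restrict f y')

/-- `M`, the largest value of the loss. -/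
def lossBound (loss : Y → Y → ℝ) : ℝ := ⨆ p : Y × Y, loss p.1 p.2

/-- `Φ(r) = min (M, max (0, r))`. -/
def clip (M r : ℝ) : ℝ := min M (max 0 r)

/-- Additive margin loss of the scoring function `h` at the example `z = (x, y)`. When `y` is the
only available output, the supremum over the empty set is `0` and so is the loss. -/
def addLoss (outputs : X → Set Y) (loss : Y → Y → ℝ) (ρ : ℝ) (h : X → Y → ℝ) (z : X × Y) : ℝ :=
  clip (lossBound loss)
    (⨆ y' : {y' : Y // y' ∈ outputs z.1 ∧ y' ≠ z.2},
      (loss y'.1 z.2 - (1 / ρ) * (h z.1 z.2 - h z.1 y'.1)))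

/-- Multiplicative margin loss of the scoring function `h` at the example `z = (x, y)`. -/
def multLoss (outputs : X → Set Y) (loss : Y → Y → ℝ) (ρ : ℝ) (h : X → Y → ℝ) (z : X × Y) : ℝ :=
  clip (lossBound loss)
    (⨆ y' : {y' : Y // y' ∈ outputs z.1 ∧ y' ≠ z.2},
      loss y'.1 z.2 * (1 - (1 / ρ) * (h z.1 z.2 - h z.1 y'.1)))

/-- Average of `g` over the sample `S`. -/
def empMean {Z : Type*} {m : ℕ} (S : Fin m → Z) (g : Z → ℝ) : ℝ := (∑ i, g (S i)) / m

/-- `p` is an argmax predictor of the scoring function `h` (ties are broken arbitrarily). -/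
def IsArgmax (outputs : X → Set Y) (h : X → Y → ℝ) (p : X → Y) : Prop :=
  ∀ x, p x ∈ outputs x ∧ ∀ y ∈ outputs x, h x y ≤ h x (p x)

section Complexity

variable {outputs : X → Set Y} {G : (z : X × Y) → FactorGraph.{_, v, w} (outputs z.1)}

/-- The indices `(i, f, y)` of the Rademacher variables: `i ∈ [m]`, `f ∈ F_i`, `y ∈ 𝒴_f`. -/
abbrev SignIndex (G : (z : X × Y) → FactorGraph.{_, v, w} (outputs z.1)) {m : ℕ}
    (S : Fin m → X × Y) : Type _ :=
  (i : Fin m) × (f : (G (S i)).Factor) × (G (S i)).LocalLabel f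

open Classical in
/-- Empirical factor graph Rademacher complexity of `H` for the sample `S`. The expectation over
independent uniform signs is the average over all sign vectors. It takes values in the extended
reals, the suprema being `⊤` when they are infinite. -/
def empComplexity (H : Set (Scoring outputs G)) {m : ℕ} (S : Fin m → X × Y) : EReal :=
  ((1 / (m : ℝ) : ℝ) : EReal) *
    (((1 / (Fintype.card (SignIndex G S → ℤˣ) : ℝ) : ℝ) : EReal) *
      ∑ ε : SignIndex G S → ℤˣ,
        ⨆ h ∈ H,
          ((∑ i : Fin m, ∑ f : (G (S i)).Factor, ∑ y : (G (S i)).LocalLabel f,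
              √(Fintype.card (G (S i)).Factor : ℝ) * ((ε ⟨i, f, y⟩ : ℤ) : ℝ)
                * h.factor (S i) f y : ℝ) : EReal))

end Complexity

/-- Measurability of a class of functions with respect to a distribution `D`: every function of the
class is measurable, and so are the suprema over the class of the weighted sums over `n` points
(up to null sets). This holds for instance for every countable class of measurable functions. -/
def IsMeasurableClass {Z ι : Type*} [MeasurableSpace Z] (D : Measure Z) (g : ι → Z → ℝ) : Prop :=
  (∀ j, AEMeasurable (g j) D) ∧
    ∀ (n : ℕ) (a : Fin n → ℝ),
      AEMeasurable (fun z : Fin n → Z => ⨆ j, ∑ i, a i * g j (z i)) (Measure.pi fun _ => D)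

end StructPred

end

open MeasureTheory StructPred

namespace StructPred

open scoped BigOperators
open Finset

/-! ### Averages over sign vectors -/

/-! The inequality between risks is pointwise: testing the supremum in a margin loss at the
predicted output shows that it dominates the loss wherever `y` is available (`loss_le_addLoss`,
`loss_le_multLoss`).

The generalization bound has two independent halves. The first is a uniform deviation bound for
functions with values in `[0, M]`. McDiarmid's inequality is applied once, to the supremum of the
deviation minus twice the empirical Rademacher complexity. Symmetrization makes the mean of this
difference nonpositive, and changing one sample point moves it by at most `M/m + 2M/m`. A single
application spends all of `δ` and produces the constant 3 (`measure_not_forall_integral_le`).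

The second half compares the Rademacher complexity of the losses with that of the local scores. At
each example a margin loss is Lipschitz in the uniform norm of the scores. By Cauchy-Schwarz over
the factors this norm is at most the Euclidean norm of the vector of all `√|F| h_f(x, y)`
(`abs_score_sub_le_localDist`). The vector contraction inequality then trades one sign per example
for one sign per pair `(f, y)`, at the cost of the constant `√2` of Khintchine's L¹-L² inequality.
That constant comes from a spectral argument on the cube: for even functions the Poincaré inequality
improves by a factor 2, and the absolute value of a linear form has a small Dirichlet form
(`khintchine_fin`).

The total constant is 2 (symmetrization) times `√2` (Khintchine) times the Lipschitz constant `2/ρ`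
or `2M/ρ`. -/

theorem expect_sign (F : ℤˣ → ℝ) : 𝔼 s, F s = (F 1 + F (-1)) / 2 := by
  rw [Fintype.expect_eq_sum_div_card]
  simp

theorem expect_fin_succ {n : ℕ} {A : Fin (n + 1) → Type*} [∀ i, Fintype (A i)]
    (F : (∀ i, A i) → ℝ) :
    𝔼 x, F x = 𝔼 a : A 0, 𝔼 y : ∀ i : Fin n, A i.succ, F (Fin.cons a y) := by
  rw [← expect_product' (univ : Finset (A 0)) (univ : Finset (∀ i : Fin n, A i.succ))
    (fun a y => F (Fin.cons a y)), univ_product_univ]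
  exact (Fintype.expect_equiv (Fin.consEquiv A) _ _ fun p => rfl).symm

theorem expect_sign_succ {n : ℕ} (F : (Fin (n + 1) → ℤˣ) → ℝ) :
    𝔼 x, F x = 𝔼 y : Fin n → ℤˣ, (F (Fin.cons 1 y) + F (Fin.cons (-1) y)) / 2 := by
  rw [expect_fin_succ, Finset.expect_comm]
  refine expect_congr rfl fun y _ => ?_
  rw [expect_sign]

/-- The sign vector `x` with its `k`-th coordinate flipped. -/
def flip {K : Type*} [DecidableEq K] (x : K → ℤˣ) (k : K) : K → ℤˣ := Function.update x k (-x k)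

/-- Twice the Dirichlet form of a function on the discrete cube. -/
noncomputable def dirichlet {n : ℕ} (f : (Fin n → ℤˣ) → ℝ) : ℝ := 𝔼 x, ∑ k, f x * (f x - f (flip x k))

/-! ### Poincaré inequalities on the cube and Khintchine's inequality -/

theorem flip_cons_zero {n : ℕ} (s : ℤˣ) (y : Fin n → ℤˣ) :
    flip (Fin.cons s y : Fin (n + 1) → ℤˣ) 0 = Fin.cons (-s) y := by
  simp [flip, Fin.update_cons_zero]

theorem flip_cons_succ {n : ℕ} (s : ℤˣ) (y : Fin n → ℤˣ) (k : Fin n) :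
    flip (Fin.cons s y : Fin (n + 1) → ℤˣ) k.succ = Fin.cons s (flip y k) := by
  simp [flip, Fin.cons_update]

/-- The even part of a function on the cube with respect to the first coordinate. -/
noncomputable def evenPart {n : ℕ} (f : (Fin (n + 1) → ℤˣ) → ℝ) (y : Fin n → ℤˣ) : ℝ :=
  (f (Fin.cons 1 y) + f (Fin.cons (-1) y)) / 2

/-- The odd part of a function on the cube with respect to the first coordinate. -/
noncomputable def oddPart {n : ℕ} (f : (Fin (n + 1) → ℤˣ) → ℝ) (y : Fin n → ℤˣ) : ℝ :=
  (f (Fin.cons 1 y) - f (Fin.cons (-1) y)) / 2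

theorem expect_succ_eq_evenPart {n : ℕ} (f : (Fin (n + 1) → ℤˣ) → ℝ) :
    𝔼 x, f x = 𝔼 y, evenPart f y := expect_sign_succ f

theorem expect_sq_succ {n : ℕ} (f : (Fin (n + 1) → ℤˣ) → ℝ) :
    𝔼 x, f x ^ 2 = 𝔼 y, evenPart f y ^ 2 + 𝔼 y, oddPart f y ^ 2 := by
  rw [expect_sign_succ, ← expect_add_distrib]
  refine expect_congr rfl fun y _ => ?_
  simp only [evenPart, oddPart]
  ring

theorem expect_mul_zero_succ {n : ℕ} (f : (Fin (n + 1) → ℤˣ) → ℝ) :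
    𝔼 x, f x * ((x 0 : ℤ) : ℝ) = 𝔼 y, oddPart f y := by
  rw [expect_sign_succ]
  refine expect_congr rfl fun y _ => ?_
  simp [oddPart]
  ring

theorem expect_mul_succ_succ {n : ℕ} (f : (Fin (n + 1) → ℤˣ) → ℝ) (k : Fin n) :
    𝔼 x, f x * ((x k.succ : ℤ) : ℝ) = 𝔼 y, evenPart f y * ((y k : ℤ) : ℝ) := by
  rw [expect_sign_succ]
  refine expect_congr rfl fun y _ => ?_
  simp [evenPart]
  ring

/-- With `f = e + x₀ o`, the flips of the other coordinates respect the splitting and the cross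
terms vanish on averaging over `x₀`. Flipping `x₀` itself contributes `2 o²`. -/
theorem dirichlet_succ {n : ℕ} (f : (Fin (n + 1) → ℤˣ) → ℝ) :
    dirichlet f = dirichlet (evenPart f) + dirichlet (oddPart f) + 2 * 𝔼 y, oddPart f y ^ 2 := by
  unfold dirichlet
  rw [expect_sign_succ, mul_expect, ← expect_add_distrib, ← expect_add_distrib]
  refine expect_congr rfl fun y _ => ?_
  simp only [Fin.sum_univ_succ, flip_cons_zero, flip_cons_succ, neg_neg]
  have h : ∑ k : Fin n, evenPart f y * (evenPart f y - evenPart f (flip y k))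
      + ∑ k : Fin n, oddPart f y * (oddPart f y - oddPart f (flip y k))
      = (∑ k : Fin n, f (Fin.cons 1 y) * (f (Fin.cons 1 y) - f (Fin.cons 1 (flip y k)))
        + ∑ k : Fin n, f (Fin.cons (-1) y) * (f (Fin.cons (-1) y) - f (Fin.cons (-1) (flip y k))))
        / 2 := by
    rw [← sum_add_distrib, ← sum_add_distrib, sum_div]
    refine sum_congr rfl fun k _ => ?_
    simp only [evenPart, oddPart]
    ring
  rw [h]
  simp only [oddPart]
  ring

/-- The Poincaré inequality on the discrete cube. -/
theorem poincare_cube : ∀ {n : ℕ} (f : (Fin n → ℤˣ) → ℝ),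
    2 * (𝔼 x, f x ^ 2 - (𝔼 x, f x) ^ 2) ≤ dirichlet f
  | 0, f => by simp [dirichlet]
  | n + 1, f => by
    have h0 := poincare_cube (evenPart f)
    have h1 := poincare_cube (oddPart f)
    have h2 : 0 ≤ 𝔼 y, oddPart f y ^ 2 - (𝔼 y, oddPart f y) ^ 2 := by
      have := expect_mul_sq_le_sq_mul_sq univ (fun _ : Fin n → ℤˣ => (1 : ℝ)) (oddPart f)
      simp only [one_mul, one_pow, expect_const univ_nonempty] at this
      linarith
    have h3 : 0 ≤ dirichlet (oddPart f) := by linarith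
    rw [dirichlet_succ, expect_sq_succ, expect_succ_eq_evenPart]
    linarith

/-- The Poincaré inequality on the discrete cube, with the doubled constant once the linear part of
the function is taken into account. -/
theorem poincare_cube_two : ∀ {n : ℕ} (f : (Fin n → ℤˣ) → ℝ),
    4 * (𝔼 x, f x ^ 2 - (𝔼 x, f x) ^ 2)
      ≤ dirichlet f + 2 * ∑ k, (𝔼 x, f x * ((x k : ℤ) : ℝ)) ^ 2
  | 0, f => by simp [dirichlet]
  | n + 1, f => by
    have h0 := poincare_cube_two (evenPart f)
    -- The mean of the odd part is the linear coefficient of the first coordinate, so the ordinary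
    -- inequality suffices here: `4 E o² = 2 E o² + 2 Var o + 2 (E o)²`.
    have h1 := poincare_cube (oddPart f)
    rw [dirichlet_succ, expect_sq_succ, expect_succ_eq_evenPart, Fin.sum_univ_succ,
      expect_mul_zero_succ]
    simp only [expect_mul_succ_succ]
    linarith

theorem expect_sq_linear : ∀ {n : ℕ} (v : Fin n → ℝ),
    𝔼 x : Fin n → ℤˣ, (∑ k, v k * ((x k : ℤ) : ℝ)) ^ 2 = ∑ k, v k ^ 2
  | 0, v => by simp
  | n + 1, v => by
    rw [expect_sign_succ, Fin.sum_univ_succ, ← expect_sq_linear fun k => v k.succ,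
      ← Fintype.expect_const (ι := Fin n → ℤˣ) (v 0 ^ 2), ← expect_add_distrib]
    refine expect_congr rfl fun y _ => ?_
    simp [Fin.sum_univ_succ]
    ring

/-- A linear form `S` is an eigenfunction: its values at the `n` neighbours of `x` add up to `(n -
2) S`. By the triangle inequality the values of `|S|` there add up to at least `(n - 2)|S|`. -/
theorem dirichlet_abs_linear_le {n : ℕ} (v : Fin n → ℝ) :
    dirichlet (fun x => |∑ k, v k * ((x k : ℤ) : ℝ)|)
      ≤ 2 * 𝔼 x : Fin n → ℤˣ, |∑ k, v k * ((x k : ℤ) : ℝ)| ^ 2 := by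
  unfold dirichlet
  rw [mul_expect]
  refine expect_le_expect fun x _ => ?_
  set S := ∑ k, v k * ((x k : ℤ) : ℝ) with hS
  have hflip : ∀ k, ∑ j, v j * ((flip x k j : ℤ) : ℝ) = S - 2 * (v k * ((x k : ℤ) : ℝ)) := by
    intro k
    have : ∑ j, v j * ((flip x k j : ℤ) : ℝ)
        = ∑ j, (v j * ((x j : ℤ) : ℝ) - if j = k then 2 * (v k * ((x k : ℤ) : ℝ)) else 0) := by
      refine sum_congr rfl fun j _ => ?_
      by_cases h : j = k
      · subst h; simp [flip]; ring
      · simp [flip, h]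
    rw [this, sum_sub_distrib]
    simp [hS]
  simp only [hflip]
  have key : (n : ℝ) * |S| - 2 * |S| ≤ ∑ k, |S - 2 * (v k * ((x k : ℤ) : ℝ))| := by
    refine le_trans ?_ (abs_sum_le_sum_abs _ _)
    rw [sum_sub_distrib, ← mul_sum, ← hS]
    simp only [sum_const, card_univ, Fintype.card_fin, nsmul_eq_mul]
    have h1 : (n : ℝ) * |S| = |(n : ℝ) * S| := by rw [abs_mul, Nat.abs_cast]
    have h2 : 2 * |S| = |2 * S| := by rw [abs_mul, abs_two]
    rw [h1, h2]
    exact abs_sub_abs_le_abs_sub _ _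
  rw [← mul_sum, sum_sub_distrib]
  simp only [sum_const, card_univ, Fintype.card_fin, nsmul_eq_mul]
  nlinarith [abs_nonneg S]

/-- The function `f = |∑ v_k x_k|` is even, so its linear coefficients vanish. The improved Poincaré
inequality and the bound on the Dirichlet form give `4 (E f² - (E f)²) ≤ 2 E f²`, that is `E f² ≤ 2
(E f)²`. -/
theorem khintchine_fin {n : ℕ} (v : Fin n → ℝ) :
    √(∑ k, v k ^ 2) ≤ √2 * 𝔼 x : Fin n → ℤˣ, |∑ k, v k * ((x k : ℤ) : ℝ)| := by
  set f : (Fin n → ℤˣ) → ℝ := fun x => |∑ k, v k * ((x k : ℤ) : ℝ)| with hf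
  have hodd : ∀ k, 𝔼 x, f x * ((x k : ℤ) : ℝ) = 0 := by
    intro k
    have : 𝔼 x, f x * ((x k : ℤ) : ℝ) = 𝔼 x, -(f x * ((x k : ℤ) : ℝ)) := by
      refine Fintype.expect_equiv (Equiv.neg _) _ _ fun x => ?_
      have : f (-x) = f x := by
        simp only [hf, Pi.neg_apply, Units.val_neg, Int.cast_neg, mul_neg, sum_neg_distrib, abs_neg]
      simp [this]
    rw [expect_neg_distrib] at this
    linarith
  have h1 := poincare_cube_two f
  have h2 : dirichlet f ≤ 2 * 𝔼 x, f x ^ 2 := dirichlet_abs_linear_le v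
  have h3 : 𝔼 x, f x ^ 2 = ∑ k, v k ^ 2 := by
    simp only [hf, sq_abs]
    exact expect_sq_linear v
  simp only [hodd] at h1
  have h4 : 0 ≤ 𝔼 x, f x := expect_nonneg fun x _ => abs_nonneg _
  refine Real.sqrt_le_iff.2 ⟨by positivity, ?_⟩
  rw [mul_pow, Real.sq_sqrt (by norm_num)]
  simp at h1
  linarith

/-- The Khintchine inequality between the first and the second moment, with the best constant. -/
theorem khintchine {K : Type*} [Fintype K] [DecidableEq K] (v : K → ℝ) :
    √(∑ k, v k ^ 2) ≤ √2 * 𝔼 x : K → ℤˣ, |∑ k, v k * ((x k : ℤ) : ℝ)| := by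
  let e := Fintype.equivFin K
  have h := khintchine_fin fun i => v (e.symm i)
  rw [e.symm.sum_comp (fun k => v k ^ 2)] at h
  refine h.trans_eq ?_
  congr 1
  refine Fintype.expect_equiv (Equiv.arrowCongr e.symm (Equiv.refl _)) _ _ fun x => ?_
  congr 1
  rw [← e.symm.sum_comp]
  simp

end StructPred

namespace StructPred

open scoped BigOperators
open Finset

/-! ### The vector contraction inequality -/

/-- Removing one scalar sign from a finite supremum at the price of a vector of signs. -/
theorem vector_contraction_single {ι K : Type*} [Finite ι] [Nonempty ι] [Fintype K] [DecidableEq K]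
    (F ψ : ι → ℝ) (v : ι → K → ℝ) (hψ : ∀ h h', |ψ h - ψ h'| ≤ √(∑ k, (v h k - v h' k) ^ 2)) :
    𝔼 s : ℤˣ, ⨆ h, (F h + ((s : ℤ) : ℝ) * ψ h)
      ≤ 𝔼 x : K → ℤˣ, ⨆ h, (F h + √2 * ∑ k, ((x k : ℤ) : ℝ) * v h k) := by
  have hb : ∀ f : ι → ℝ, BddAbove (Set.range f) := fun f => (Set.finite_range f).bddAbove
  set R : (K → ℤˣ) → ℝ := fun x => ⨆ h, (F h + √2 * ∑ k, ((x k : ℤ) : ℝ) * v h k) with hR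
  have hneg : 𝔼 x, R (-x) = 𝔼 x, R x := Fintype.expect_equiv (Equiv.neg _) _ _ fun x => rfl
  have hpair : ∀ h h', F h + ψ h + (F h' - ψ h') ≤ 2 * 𝔼 x, R x := by
    intro h h'
    have h1 : ψ h - ψ h' ≤ √2 * 𝔼 x : K → ℤˣ, |∑ k, (v h k - v h' k) * ((x k : ℤ) : ℝ)| :=
      (le_abs_self _).trans ((hψ h h').trans (khintchine _))
    -- For each `x`, the sign of the inner sum decides whether `h` is tested at `x` and `h'` at
    -- `-x`, or the other way round.
    have h2 : F h + F h' + √2 * 𝔼 x : K → ℤˣ, |∑ k, (v h k - v h' k) * ((x k : ℤ) : ℝ)|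
        ≤ 𝔼 x, (R x + R (-x)) := by
      rw [mul_expect, ← Fintype.expect_const (ι := K → ℤˣ) (F h + F h'), ← expect_add_distrib]
      refine expect_le_expect fun x _ => ?_
      have a1 := le_ciSup (hb fun h => F h + √2 * ∑ k, ((x k : ℤ) : ℝ) * v h k) h
      have a2 := le_ciSup (hb fun h => F h + √2 * ∑ k, ((x k : ℤ) : ℝ) * v h k) h'
      have a3 := le_ciSup (hb fun h => F h + √2 * ∑ k, (((-x) k : ℤ) : ℝ) * v h k) h
      have a4 := le_ciSup (hb fun h => F h + √2 * ∑ k, (((-x) k : ℤ) : ℝ) * v h k) h'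
      change _ ≤ R x at a1 a2
      change _ ≤ R (-x) at a3 a4
      simp only [Pi.neg_apply, Units.val_neg, Int.cast_neg, neg_mul, sum_neg_distrib] at a3 a4
      have e : ∑ k, (v h k - v h' k) * ((x k : ℤ) : ℝ)
          = ∑ k, ((x k : ℤ) : ℝ) * v h k - ∑ k, ((x k : ℤ) : ℝ) * v h' k := by
        rw [← sum_sub_distrib]
        exact sum_congr rfl fun k _ => by ring
      rw [e]
      rcases abs_cases (∑ k, ((x k : ℤ) : ℝ) * v h k - ∑ k, ((x k : ℤ) : ℝ) * v h' k) with
        ⟨hc, _⟩ | ⟨hc, _⟩ <;> rw [hc] <;> linarith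
    rw [expect_add_distrib, hneg] at h2
    linarith
  rw [expect_sign]
  have h1 : (⨆ h, (F h + (((1 : ℤˣ) : ℤ) : ℝ) * ψ h))
      ≤ 2 * 𝔼 x, R x - ⨆ h, (F h + (((-1 : ℤˣ) : ℤ) : ℝ) * ψ h) := by
    refine ciSup_le fun h => ?_
    rw [le_sub_comm]
    refine ciSup_le fun h' => ?_
    have := hpair h h'
    simp only [Units.val_one, Int.cast_one, one_mul, Units.val_neg, Int.cast_neg, neg_mul]
    linarith
  linarith

/-- The vector contraction inequality for finite classes, with constant `√2`. -/
theorem vector_contraction {ι : Type*} [Finite ι] [Nonempty ι] :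
    ∀ {m : ℕ} (K : Fin m → Type*) [∀ i, Fintype (K i)] [∀ i, DecidableEq (K i)]
      (F : ι → ℝ) (ψ : ι → Fin m → ℝ) (v : ι → (i : Fin m) → K i → ℝ)
      (_ : ∀ i h h', |ψ h i - ψ h' i| ≤ √(∑ k, (v h i k - v h' i k) ^ 2)),
      𝔼 s : Fin m → ℤˣ, ⨆ h, (F h + ∑ i, ((s i : ℤ) : ℝ) * ψ h i)
        ≤ 𝔼 x : (i : Fin m) → K i → ℤˣ,
            ⨆ h, (F h + √2 * ∑ i, ∑ k, ((x i k : ℤ) : ℝ) * v h i k)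
  | 0, K, _, _, F, ψ, v, _ => by simp
  | m + 1, K, _, _, F, ψ, v, hψ => by
    rw [expect_fin_succ, expect_fin_succ]
    calc 𝔼 s : ℤˣ, 𝔼 y : Fin m → ℤˣ, ⨆ h, (F h + ∑ i : Fin (m + 1),
            ((((Fin.cons s y : Fin (m + 1) → ℤˣ) i : ℤˣ) : ℤ) : ℝ) * ψ h i)
        = 𝔼 s : ℤˣ, 𝔼 y : Fin m → ℤˣ, ⨆ h, ((F h + ((s : ℤ) : ℝ) * ψ h 0)
            + ∑ i, ((y i : ℤ) : ℝ) * ψ h i.succ) := by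
          simp only [Fin.sum_univ_succ, Fin.cons_zero, Fin.cons_succ, add_assoc]
      -- The offset `F` is arbitrary, so it can absorb the first term while the others are
      -- contracted, and afterwards the contracted terms while the first one is.
      _ ≤ 𝔼 s : ℤˣ, 𝔼 x : (i : Fin m) → K i.succ → ℤˣ, ⨆ h, ((F h + ((s : ℤ) : ℝ) * ψ h 0)
            + √2 * ∑ i, ∑ k, ((x i k : ℤ) : ℝ) * v h i.succ k) :=
          expect_le_expect fun s _ => vector_contraction (fun i => K i.succ)
            (fun h => F h + ((s : ℤ) : ℝ) * ψ h 0) (fun h i => ψ h i.succ)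
            (fun h i => v h i.succ) (fun i => hψ i.succ)
      _ = 𝔼 x : (i : Fin m) → K i.succ → ℤˣ, 𝔼 s : ℤˣ,
            ⨆ h, ((F h + √2 * ∑ i, ∑ k, ((x i k : ℤ) : ℝ) * v h i.succ k)
              + ((s : ℤ) : ℝ) * ψ h 0) := by
          rw [Finset.expect_comm]
          simp only [add_right_comm]
      _ ≤ 𝔼 x : (i : Fin m) → K i.succ → ℤˣ, 𝔼 x₀ : K 0 → ℤˣ,
            ⨆ h, ((F h + √2 * ∑ i, ∑ k, ((x i k : ℤ) : ℝ) * v h i.succ k)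
              + √2 * ∑ k, ((x₀ k : ℤ) : ℝ) * v h 0 k) :=
          expect_le_expect fun x _ => vector_contraction_single _ _ _ (hψ 0)
      _ = _ := by
          rw [Finset.expect_comm]
          refine expect_congr rfl fun x₀ _ => expect_congr rfl fun x _ => ?_
          refine iSup_congr fun h => ?_
          simp only [Fin.sum_univ_succ, Fin.cons_zero, Fin.cons_succ]
          ring

end StructPred

namespace StructPred

open ProbabilityTheory

/-! ### Lower means and McDiarmid's inequality -/

/-- The mean of a function bounded by `K`, defined through the lower Lebesgue integral so that it is
monotone without any measurability assumption. -/
noncomputable def lowerMean {α : Type*} [MeasurableSpace α] (μ : Measure α) (K : ℝ) (f : α → ℝ) : ℝ :=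
  (∫⁻ x, ENNReal.ofReal (f x + K) ∂μ).toReal - K

section LowerMean

variable {α : Type*} [MeasurableSpace α] {μ : Measure α} [IsProbabilityMeasure μ] {K : ℝ}
  {f g : α → ℝ}

theorem lintegral_shift_le (hf : ∀ x, |f x| ≤ K) :
    ∫⁻ x, ENNReal.ofReal (f x + K) ∂μ ≤ ENNReal.ofReal (2 * K) := by
  calc ∫⁻ x, ENNReal.ofReal (f x + K) ∂μ ≤ ∫⁻ _, ENNReal.ofReal (2 * K) ∂μ :=
        lintegral_mono fun x => ENNReal.ofReal_le_ofReal (by linarith [(abs_le.1 (hf x)).2])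
    _ = ENNReal.ofReal (2 * K) := by simp

theorem abs_lowerMean_le (hK : 0 ≤ K) (hf : ∀ x, |f x| ≤ K) : |lowerMean μ K f| ≤ K := by
  have h1 := ENNReal.toReal_le_of_le_ofReal (by linarith) (lintegral_shift_le (μ := μ) hf)
  have h2 : 0 ≤ (∫⁻ x, ENNReal.ofReal (f x + K) ∂μ).toReal := ENNReal.toReal_nonneg
  unfold lowerMean
  rw [abs_le]
  constructor <;> linarith

/-- Neither function need be measurable. This lets bounded differences hold at every sample,
although sections of a measurable function on a product are only almost surely measurable. -/
theorem lowerMean_le_add (hg : ∀ x, |g x| ≤ K) {c : ℝ} (hc : 0 ≤ c)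
    (h : ∀ x, f x ≤ g x + c) : lowerMean μ K f ≤ lowerMean μ K g + c := by
  have h1 : ∫⁻ x, ENNReal.ofReal (f x + K) ∂μ
      ≤ ∫⁻ x, ENNReal.ofReal (g x + K) ∂μ + ENNReal.ofReal c := by
    calc ∫⁻ x, ENNReal.ofReal (f x + K) ∂μ
        ≤ ∫⁻ x, (ENNReal.ofReal (g x + K) + ENNReal.ofReal c) ∂μ := by
          refine lintegral_mono fun x => ?_
          rw [← ENNReal.ofReal_add (by linarith [(abs_le.1 (hg x)).1]) hc]
          exact ENNReal.ofReal_le_ofReal (by linarith [h x])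
      _ = _ := by rw [lintegral_add_right _ measurable_const]; simp
  have hgt : ∫⁻ x, ENNReal.ofReal (g x + K) ∂μ ≠ ⊤ :=
    ne_top_of_le_ne_top ENNReal.ofReal_ne_top (lintegral_shift_le hg)
  have h2 := ENNReal.toReal_mono (ENNReal.add_ne_top.2 ⟨hgt, ENNReal.ofReal_ne_top⟩) h1
  rw [ENNReal.toReal_add hgt ENNReal.ofReal_ne_top, ENNReal.toReal_ofReal hc] at h2
  unfold lowerMean
  linarith

theorem integrable_of_abs_le (hm : AEMeasurable f μ) (hf : ∀ x, |f x| ≤ K) : Integrable f μ :=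
  Integrable.of_bound hm.aestronglyMeasurable K (Filter.Eventually.of_forall hf)

theorem lowerMean_eq_integral (hm : AEMeasurable f μ) (hf : ∀ x, |f x| ≤ K) :
    lowerMean μ K f = ∫ x, f x ∂μ := by
  have hi : Integrable f μ := integrable_of_abs_le hm hf
  have h1 : ∫ x, (f x + K) ∂μ = ∫ x, f x ∂μ + K := by
    rw [integral_add hi (integrable_const _)]; simp
  have h2 : ∫ x, (f x + K) ∂μ = (∫⁻ x, ENNReal.ofReal (f x + K) ∂μ).toReal :=
    integral_eq_lintegral_of_nonneg_ae
      (Filter.Eventually.of_forall fun x => by simp; linarith [(abs_le.1 (hf x)).1])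
      (hm.add_const _).aestronglyMeasurable
  unfold lowerMean
  linarith

end LowerMean

variable {Z : Type*} [MeasurableSpace Z]

theorem measurePreserving_cons (D : Measure Z) [IsProbabilityMeasure D] (n : ℕ) :
    MeasurePreserving (fun p : (Fin n → Z) × Z => (Fin.cons p.2 p.1 : Fin (n + 1) → Z))
      ((Measure.pi fun _ => D).prod D) (Measure.pi fun _ => D) := by
  have h := ((measurePreserving_piFinSuccAbove (fun _ : Fin (n + 1) => D) 0).symm).comp
    (Measure.measurePreserving_swap (μ := Measure.pi fun _ : Fin n => D) (ν := D))
  convert h using 1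
  ext p i
  simp [MeasurableEquiv.piFinSuccAbove, Fin.insertNthEquiv]

theorem abs_exp_mul_le {t x K : ℝ} (hx : |x| ≤ K) : |Real.exp (t * x)| ≤ Real.exp (|t| * K) := by
  rw [Real.abs_exp]
  refine Real.exp_le_exp.2 ((le_abs_self _).trans ?_)
  rw [abs_mul]
  exact mul_le_mul_of_nonneg_left hx (abs_nonneg _)

/-- Hoeffding's lemma for a function of oscillation at most `c`. -/
theorem integral_exp_le_of_oscillation {D : Measure Z} [IsProbabilityMeasure D] {f : Z → ℝ}
    (hm : AEMeasurable f D) {K c : ℝ} (hf : ∀ z, |f z| ≤ K) (hc : ∀ z z', f z ≤ f z' + c) (t : ℝ) :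
    ∫ z, Real.exp (t * f z) ∂D ≤ Real.exp (t * ∫ z, f z ∂D + (c / 2) ^ 2 * t ^ 2 / 2) := by
  have : Nonempty Z := D.nonempty_of_neZero
  have hbdd : BddBelow (Set.range f) := ⟨-K, by rintro _ ⟨z, rfl⟩; exact (abs_le.1 (hf z)).1⟩
  have hmem : ∀ z, f z ∈ Set.Icc (⨅ z, f z) ((⨅ z, f z) + c) := fun z =>
    ⟨ciInf_le hbdd z, by
      rw [← sub_le_iff_le_add]
      exact le_ciInf fun z' => by linarith [hc z z']⟩
  have h := (hasSubgaussianMGF_of_mem_Icc hm (Filter.Eventually.of_forall hmem)).mgf_le t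
  simp only [mgf, add_sub_cancel_left] at h
  have e : ∀ z, Real.exp (t * (f z - ∫ x, f x ∂D))
      = Real.exp (t * f z) * Real.exp (-(t * ∫ x, f x ∂D)) := fun z => by
    rw [← Real.exp_add]; ring_nf
  simp only [e] at h
  rw [integral_mul_const, Real.exp_neg, ← div_eq_mul_inv, div_le_iff₀ (Real.exp_pos _),
    ← Real.exp_add] at h
  refine h.trans_eq ?_
  congr 1
  push_cast
  rw [Real.norm_eq_abs, div_pow, sq_abs, div_pow]
  ring

/-- McDiarmid's inequality for the moment generating function. -/
theorem integral_exp_le_of_bounded_differences {D : Measure Z} [IsProbabilityMeasure D]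
    {K c : ℝ} (hK : 0 ≤ K) (hc0 : 0 ≤ c) (t : ℝ) : ∀ {n : ℕ} {f : (Fin n → Z) → ℝ}
      (_ : AEMeasurable f (Measure.pi fun _ => D)) (_ : ∀ S, |f S| ≤ K)
      (_ : ∀ S i z, f S ≤ f (Function.update S i z) + c),
      ∫ S, Real.exp (t * f S) ∂(Measure.pi fun _ => D)
        ≤ Real.exp (t * ∫ S, f S ∂(Measure.pi fun _ => D) + n * (c / 2) ^ 2 * t ^ 2 / 2)
  | 0, f, _, _, _ => by
    have : ∀ S, f S = f default := fun S => congrArg f (Subsingleton.elim _ _)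
    simp [this]
  | n + 1, f, hm, hf, hc => by
    set P : Measure (Fin n → Z) := Measure.pi fun _ => D
    have mp := measurePreserving_cons D n
    set g : (Fin n → Z) × Z → ℝ := fun p => f (Fin.cons p.2 p.1) with hg
    have hgm : AEMeasurable g (P.prod D) := hm.comp_quasiMeasurePreserving mp.quasiMeasurePreserving
    have hgK : ∀ p, |g p| ≤ K := fun p => hf _
    have htransfer : ∀ F : (Fin (n + 1) → Z) → ℝ, AEMeasurable F (Measure.pi fun _ => D) →
        ∫ S, F S ∂(Measure.pi fun _ => D) = ∫ p, F (Fin.cons p.2 p.1) ∂(P.prod D) := by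
      intro F hF
      rw [← mp.map_eq, integral_map mp.measurable.aemeasurable]
      rw [mp.map_eq]
      exact hF.aestronglyMeasurable
    have hem : AEMeasurable (fun p => Real.exp (t * g p)) (P.prod D) := by fun_prop
    rw [htransfer _ hm, htransfer _ (by fun_prop), integral_prod _ (integrable_of_abs_le hgm hgK),
      integral_prod _ (integrable_of_abs_le hem fun p => abs_exp_mul_le (hgK p))]
    have hsec : ∀ᵐ S ∂P, AEMeasurable (fun z => g (S, z)) D := by
      filter_upwards [hgm.aestronglyMeasurable.prodMk_left] with S hS using hS.aemeasurable
    -- The partial mean over the first coordinate. As a lower mean it inherits the bound and the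
    -- bounded differences everywhere, as the induction hypothesis requires.
    set F : (Fin n → Z) → ℝ := fun S => lowerMean D K fun z => g (S, z) with hF
    have hFeq : F =ᵐ[P] fun S => ∫ z, g (S, z) ∂D := by
      filter_upwards [hsec] with S hS using lowerMean_eq_integral hS fun z => hgK _
    have hFm : AEMeasurable F P :=
      (hgm.aestronglyMeasurable.integral_prod_right'.aemeasurable).congr hFeq.symm
    have hFK : ∀ S, |F S| ≤ K := fun S => abs_lowerMean_le hK fun z => hgK _
    have hFc : ∀ S i z, F S ≤ F (Function.update S i z) + c := by
      intro S i z
      refine lowerMean_le_add (fun _ => hgK _) hc0 fun w => ?_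
      have := hc (Fin.cons w S) i.succ z
      rwa [← Fin.cons_update] at this
    have ih := integral_exp_le_of_bounded_differences hK hc0 t hFm hFK hFc
    have hFexp : AEMeasurable (fun S => Real.exp (t * F S)) P := by fun_prop
    calc ∫ S, ∫ z, Real.exp (t * g (S, z)) ∂D ∂P
        ≤ ∫ S, Real.exp (t * F S) * Real.exp ((c / 2) ^ 2 * t ^ 2 / 2) ∂P := by
          refine integral_mono_ae
            (integrable_of_abs_le hem fun p => abs_exp_mul_le (hgK p)).integral_prod_left
            ((integrable_of_abs_le hFexp fun S => abs_exp_mul_le (hFK S)).mul_const _) ?_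
          filter_upwards [hsec, hFeq] with S hS hS'
          rw [← Real.exp_add, hS']
          refine integral_exp_le_of_oscillation hS (fun z => hgK _) (fun z z' => ?_) t
          have := hc (Fin.cons z S) 0 z'
          rwa [Fin.update_cons_zero] at this
      _ = (∫ S, Real.exp (t * F S) ∂P) * Real.exp ((c / 2) ^ 2 * t ^ 2 / 2) :=
          integral_mul_const _ _
      _ ≤ Real.exp (t * ∫ S, F S ∂P + n * (c / 2) ^ 2 * t ^ 2 / 2)
            * Real.exp ((c / 2) ^ 2 * t ^ 2 / 2) := by gcongr
      _ = Real.exp (t * ∫ S, ∫ z, g (S, z) ∂D ∂P + (n + 1 : ℕ) * (c / 2) ^ 2 * t ^ 2 / 2) := by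
          rw [← Real.exp_add, integral_congr_ae hFeq]
          congr 1
          push_cast
          ring

/-- McDiarmid's inequality. -/
theorem measure_ge_le_of_bounded_differences {D : Measure Z} [IsProbabilityMeasure D] {n : ℕ}
    {f : (Fin n → Z) → ℝ} (hm : AEMeasurable f (Measure.pi fun _ => D))
    {K c : ℝ} (hc0 : 0 ≤ c) (hf : ∀ S, |f S| ≤ K)
    (hc : ∀ S i z, f S ≤ f (Function.update S i z) + c) {r : ℝ} (hr : 0 ≤ r) :
    (Measure.pi fun _ => D).real {S | r ≤ f S - ∫ S, f S ∂(Measure.pi fun _ => D)}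
      ≤ Real.exp (-r ^ 2 / (2 * (n * (c / 2) ^ 2))) := by
  set P : Measure (Fin n → Z) := Measure.pi fun _ => D
  have : Nonempty (Fin n → Z) := P.nonempty_of_neZero
  have hK : 0 ≤ K := (abs_nonneg _).trans (hf (Classical.arbitrary _))
  have hexp : ∀ t S, Real.exp (t * (f S - ∫ S, f S ∂P))
      = Real.exp (t * f S) * Real.exp (-(t * ∫ S, f S ∂P)) := fun t S => by
    rw [← Real.exp_add]; ring_nf
  have h : HasSubgaussianMGF (fun S => f S - ∫ S, f S ∂P) (Real.toNNReal (n * (c / 2) ^ 2)) P := by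
    refine ⟨fun t => ?_, fun t => ?_⟩
    · simp only [hexp]
      have hem : AEMeasurable (fun S => Real.exp (t * f S)) P := by fun_prop
      exact (integrable_of_abs_le hem fun S => abs_exp_mul_le (hf S)).mul_const _
    · simp only [mgf, hexp]
      rw [integral_mul_const, Real.coe_toNNReal _ (by positivity), Real.exp_neg, ← div_eq_mul_inv,
        div_le_iff₀ (Real.exp_pos _), ← Real.exp_add, add_comm]
      exact integral_exp_le_of_bounded_differences hK hc0 t hm hf hc
  have := h.measure_ge_le hr
  rwa [Real.coe_toNNReal _ (by positivity)] at this

end StructPred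

namespace StructPred

open scoped BigOperators
open Finset

/-! ### Weighted suprema and symmetrization -/

section WeightedSup

variable {Z ι κ : Type*} [Fintype κ]

/-- The supremum over a class of functions of their weighted sums over finitely many points. -/
noncomputable def weightedSup (g : ι → Z → ℝ) (a : κ → ℝ) (z : κ → Z) : ℝ :=
  ⨆ j, ∑ i, a i * g j (z i)

variable {g : ι → Z → ℝ} {M : ℝ}

theorem abs_weighted_sum_le (hg0 : ∀ j z, 0 ≤ g j z) (hgM : ∀ j z, g j z ≤ M) (a : κ → ℝ)
    (z : κ → Z) (j : ι) : |∑ i, a i * g j (z i)| ≤ (∑ i, |a i|) * M := by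
  rw [sum_mul]
  refine (abs_sum_le_sum_abs _ _).trans (sum_le_sum fun i _ => ?_)
  rw [abs_mul, abs_of_nonneg (hg0 _ _)]
  exact mul_le_mul_of_nonneg_left (hgM _ _) (abs_nonneg _)

theorem bddAbove_weighted_sum (hg0 : ∀ j z, 0 ≤ g j z) (hgM : ∀ j z, g j z ≤ M) (a : κ → ℝ)
    (z : κ → Z) : BddAbove (Set.range fun j => ∑ i, a i * g j (z i)) :=
  ⟨_, by rintro _ ⟨j, rfl⟩; exact (abs_le.1 (abs_weighted_sum_le hg0 hgM a z j)).2⟩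

theorem abs_weightedSup_le [Nonempty ι] (hg0 : ∀ j z, 0 ≤ g j z) (hgM : ∀ j z, g j z ≤ M)
    (a : κ → ℝ) (z : κ → Z) : |weightedSup g a z| ≤ (∑ i, |a i|) * M := by
  refine abs_le.2 ⟨?_, ciSup_le fun j => (abs_le.1 (abs_weighted_sum_le hg0 hgM a z j)).2⟩
  obtain ⟨j⟩ := ‹Nonempty ι›
  exact (abs_le.1 (abs_weighted_sum_le hg0 hgM a z j)).1.trans
    (le_ciSup (bddAbove_weighted_sum hg0 hgM a z) j)

theorem weightedSup_le_update [Nonempty ι] [DecidableEq κ] (hg0 : ∀ j z, 0 ≤ g j z)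
    (hgM : ∀ j z, g j z ≤ M) (a : κ → ℝ) (z : κ → Z) (k : κ) (w : Z) :
    weightedSup g a z ≤ weightedSup g a (Function.update z k w) + |a k| * M := by
  refine ciSup_le fun j => ?_
  refine le_trans ?_ (add_le_add_left
    (le_ciSup (bddAbove_weighted_sum hg0 hgM a (Function.update z k w)) j) _)
  rw [← sub_le_iff_le_add', ← sum_sub_distrib, sum_eq_single k]
  · rw [Function.update_self, ← mul_sub]
    refine (le_abs_self _).trans ?_
    rw [abs_mul]
    refine mul_le_mul_of_nonneg_left (abs_le.2 ⟨?_, ?_⟩) (abs_nonneg _)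
    · linarith [hg0 j (z k), hgM j w]
    · linarith [hg0 j w, hgM j (z k)]
  · intro i _ hi
    rw [Function.update_of_ne hi, sub_self]
  · simp

theorem weightedSup_elim_le [Nonempty ι] {κ' : Type*} [Fintype κ'] (hg0 : ∀ j z, 0 ≤ g j z)
    (hgM : ∀ j z, g j z ≤ M) (a : κ → ℝ) (b : κ' → ℝ) (z : κ → Z) (w : κ' → Z) :
    weightedSup g (Sum.elim a b) (Sum.elim z w) ≤ weightedSup g a z + weightedSup g b w := by
  refine ciSup_le fun j => ?_
  simp only [Fintype.sum_sum_type, Sum.elim_inl, Sum.elim_inr]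
  exact add_le_add (le_ciSup (bddAbove_weighted_sum hg0 hgM a z) j)
    (le_ciSup (bddAbove_weighted_sum hg0 hgM b w) j)

theorem weightedSup_comp_equiv {κ' : Type*} [Fintype κ'] (e : κ' ≃ κ) (a : κ' → ℝ) (z : κ → Z) :
    weightedSup g a (z ∘ e) = weightedSup g (a ∘ e.symm) z := by
  refine iSup_congr fun j => ?_
  rw [← e.sum_comp]
  simp

end WeightedSup

variable {Z ι : Type*} [MeasurableSpace Z] {D : Measure Z} [IsProbabilityMeasure D]

theorem measurePreserving_comp_equiv {κ κ' : Type*} [Fintype κ] [Fintype κ'] (e : κ' ≃ κ) :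
    MeasurePreserving (fun z : κ → Z => z ∘ e) (Measure.pi fun _ => D) (Measure.pi fun _ => D) := by
  have h := measurePreserving_piCongrLeft (α := fun _ => Z) (fun _ : κ' => D) e.symm
  convert h using 1
  ext z i
  rw [MeasurableEquiv.coe_piCongrLeft]
  have := Equiv.piCongrLeft_apply_apply (P := fun _ : κ' => Z) (e := e.symm) (f := z) (a := e i)
  rw [e.symm_apply_apply] at this
  exact this.symm

theorem measurePreserving_elim {κ κ' : Type*} [Fintype κ] [Fintype κ'] :
    MeasurePreserving (fun p : (κ → Z) × (κ' → Z) => (Sum.elim p.1 p.2 : κ ⊕ κ' → Z))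
      ((Measure.pi fun _ => D).prod (Measure.pi fun _ => D)) (Measure.pi fun _ => D) := by
  have h := measurePreserving_sumPiEquivProdPi_symm (X := fun _ : κ ⊕ κ' => Z) fun _ => D
  convert h using 1
  ext p i
  rcases i with i | i <;> rfl

theorem MeasurePreserving.integral_comp_ae {α β : Type*} [MeasurableSpace α] [MeasurableSpace β]
    {μ : Measure α} {ν : Measure β} {T : α → β} (h : MeasurePreserving T μ ν) {F : β → ℝ}
    (hF : AEMeasurable F ν) : ∫ x, F (T x) ∂μ = ∫ y, F y ∂ν := by
  rw [← h.map_eq, integral_map h.measurable.aemeasurable]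
  rw [h.map_eq]
  exact hF.aestronglyMeasurable

variable {g : ι → Z → ℝ} {M : ℝ}

theorem IsMeasurableClass.aemeasurable_weightedSup (hg : IsMeasurableClass D g) {κ : Type*}
    [Fintype κ] (a : κ → ℝ) :
    AEMeasurable (weightedSup g a) (Measure.pi fun _ : κ => D) := by
  have e := (Fintype.equivFin κ).symm
  have h := (hg.2 _ (a ∘ e)).comp_quasiMeasurePreserving
    (measurePreserving_comp_equiv (D := D) e).quasiMeasurePreserving
  refine h.congr (Filter.Eventually.of_forall fun z => ?_)
  refine (weightedSup_comp_equiv e (a ∘ e) z).trans ?_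
  congr 1
  ext i
  simp

/-- The exchange of the two halves of a double sample at the coordinates with a negative sign. -/
def signSwap {m : ℕ} (s : Fin m → ℤˣ) : Equiv.Perm (Fin m ⊕ Fin m) :=
  Function.Involutive.toPerm
    (Sum.elim (fun i => if s i = 1 then Sum.inl i else Sum.inr i)
      (fun i => if s i = 1 then Sum.inr i else Sum.inl i))
    (by rintro (i | i) <;> by_cases h : s i = 1 <;> simp [h])

/-- Exchanging a sample point with its ghost where `s i = -1` turns the weights `±r` into `± s i r`.
-/
theorem elim_comp_signSwap {m : ℕ} (s : Fin m → ℤˣ) (r : ℝ) :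
    (Sum.elim (fun _ => r) (fun _ => -r) : Fin m ⊕ Fin m → ℝ) ∘ (signSwap s).symm
      = Sum.elim (fun i => ((s i : ℤ) : ℝ) * r) (fun i => ((((-s) i : ℤˣ) : ℤ) : ℝ) * r) := by
  ext i
  rcases i with i | i <;> rcases Int.units_eq_one_or (s i) with h | h <;>
    simp [signSwap, Function.Involutive.toPerm, h]

/-- The empirical Rademacher complexity of a class of functions. -/
noncomputable def rademacher (g : ι → Z → ℝ) {m : ℕ} (S : Fin m → Z) : ℝ :=
  𝔼 s : Fin m → ℤˣ, weightedSup g (fun i => ((s i : ℤ) : ℝ) * (1 / m)) S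

/-- The supremum over the class of the difference between the averages over a fresh sample and over
`S`, averaged over the fresh sample. -/
noncomputable def ghostDeviation (D : Measure Z) (M : ℝ) (g : ι → Z → ℝ) {m : ℕ}
    (S : Fin m → Z) : ℝ :=
  lowerMean (Measure.pi fun _ : Fin m => D) (2 * M) fun S' =>
    weightedSup g (Sum.elim (fun _ => 1 / (m : ℝ)) (fun _ => -(1 / (m : ℝ)))) (Sum.elim S' S)

theorem abs_sign_mul (s : ℤˣ) (r : ℝ) : |((s : ℤ) : ℝ) * r| = |r| := by
  rcases Int.units_eq_one_or s with h | h <;> simp [h]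

theorem sum_abs_inv_card {m : ℕ} (hm : 0 < m) : ∑ _i : Fin m, |1 / (m : ℝ)| = 1 := by
  have : (m : ℝ) ≠ 0 := by positivity
  simp [this]

theorem abs_sign_weightedSup_le {Z : Type*} {g : ι → Z → ℝ} [Nonempty ι] {m : ℕ} (hm : 0 < m)
    (hg0 : ∀ j z, 0 ≤ g j z) (hgM : ∀ j z, g j z ≤ M)
    (s : Fin m → ℤˣ) (S : Fin m → Z) :
    |weightedSup g (fun i => ((s i : ℤ) : ℝ) * (1 / m)) S| ≤ M := by
  refine (abs_weightedSup_le hg0 hgM _ S).trans_eq ?_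
  simp only [abs_sign_mul]
  rw [sum_abs_inv_card hm, one_mul]

theorem abs_double_weightedSup_le {Z : Type*} {g : ι → Z → ℝ} [Nonempty ι] {m : ℕ} (hm : 0 < m)
    (hg0 : ∀ j z, 0 ≤ g j z) (hgM : ∀ j z, g j z ≤ M)
    (W : Fin m ⊕ Fin m → Z) :
    |weightedSup g (Sum.elim (fun _ => 1 / (m : ℝ)) (fun _ => -(1 / (m : ℝ)))) W| ≤ 2 * M := by
  refine (abs_weightedSup_le hg0 hgM _ W).trans_eq ?_
  rw [Fintype.sum_sum_type]
  simp only [Sum.elim_inl, Sum.elim_inr, abs_neg]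
  rw [sum_abs_inv_card hm]
  ring

theorem abs_rademacher_le {Z : Type*} {g : ι → Z → ℝ} [Nonempty ι] {m : ℕ} (hm : 0 < m)
    (hg0 : ∀ j z, 0 ≤ g j z) (hgM : ∀ j z, g j z ≤ M)
    (S : Fin m → Z) : |rademacher g S| ≤ M :=
  (abs_expect_le _ _).trans
    (expect_le univ_nonempty fun s _ => abs_sign_weightedSup_le hm hg0 hgM s S)

end StructPred

/-! ### Symmetrization and the uniform deviation bound -/

namespace StructPred

open scoped BigOperators
open Finset

variable {Z ι : Type*} [MeasurableSpace Z] {D : Measure Z} [IsProbabilityMeasure D]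
  {g : ι → Z → ℝ} {M : ℝ}

theorem aemeasurable_expect {α β : Type*} [MeasurableSpace α] [Fintype β] {μ : Measure α}
    {F : β → α → ℝ} (hF : ∀ b, AEMeasurable (F b) μ) :
    AEMeasurable (fun x => 𝔼 b, F b x) μ := by
  simp only [Fintype.expect_eq_sum_div_card]
  exact (Finset.aemeasurable_fun_sum _ fun b _ => hF b).div_const _

theorem IsMeasurableClass.aemeasurable_rademacher (hg : IsMeasurableClass D g) {m : ℕ} :
    AEMeasurable (rademacher g) (Measure.pi fun _ : Fin m => D) :=
  aemeasurable_expect fun _ => hg.aemeasurable_weightedSup _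

theorem IsMeasurableClass.aemeasurable_double (hg : IsMeasurableClass D g) {m : ℕ}
    (a : Fin m ⊕ Fin m → ℝ) :
    AEMeasurable (fun p : (Fin m → Z) × (Fin m → Z) => weightedSup g a (Sum.elim p.2 p.1))
      ((Measure.pi fun _ => D).prod (Measure.pi fun _ => D)) :=
  (hg.aemeasurable_weightedSup a).comp_quasiMeasurePreserving
    ((measurePreserving_elim (D := D)).comp Measure.measurePreserving_swap).quasiMeasurePreserving

theorem ghostDeviation_ae_eq [Nonempty ι] (hg : IsMeasurableClass D g)
    (hg0 : ∀ j z, 0 ≤ g j z) (hgM : ∀ j z, g j z ≤ M) {m : ℕ} (hm : 0 < m) :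
    (ghostDeviation D M g : (Fin m → Z) → ℝ) =ᵐ[Measure.pi fun _ => D] fun S =>
      ∫ S' : Fin m → Z, weightedSup g (Sum.elim (fun _ => 1 / (m : ℝ)) (fun _ => -(1 / (m : ℝ))))
        (Sum.elim S' S) ∂(Measure.pi fun _ => D) := by
  filter_upwards [(hg.aemeasurable_double (Sum.elim (fun _ => 1 / (m : ℝ))
    (fun _ => -(1 / (m : ℝ))))).aestronglyMeasurable.prodMk_left] with S hS
  exact lowerMean_eq_integral hS.aemeasurable fun S' => abs_double_weightedSup_le hm hg0 hgM _

theorem aemeasurable_ghostDeviation [Nonempty ι] (hg : IsMeasurableClass D g)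
    (hg0 : ∀ j z, 0 ≤ g j z) (hgM : ∀ j z, g j z ≤ M) {m : ℕ} (hm : 0 < m) :
    AEMeasurable (ghostDeviation D M g : (Fin m → Z) → ℝ) (Measure.pi fun _ => D) :=
  (hg.aemeasurable_double _).aestronglyMeasurable.integral_prod_right'.aemeasurable.congr
    (ghostDeviation_ae_eq hg hg0 hgM hm).symm

/-- Symmetrization. -/
theorem integral_ghostDeviation_le [Nonempty ι] (hg : IsMeasurableClass D g)
    (hg0 : ∀ j z, 0 ≤ g j z) (hgM : ∀ j z, g j z ≤ M) {m : ℕ} (hm : 0 < m) :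
    ∫ S : Fin m → Z, ghostDeviation D M g S ∂(Measure.pi fun _ => D)
      ≤ 2 * ∫ S : Fin m → Z, rademacher g S ∂(Measure.pi fun _ => D) := by
  set P : Measure (Fin m → Z) := Measure.pi fun _ => D
  set b : Fin m ⊕ Fin m → ℝ := Sum.elim (fun _ => 1 / (m : ℝ)) (fun _ => -(1 / (m : ℝ))) with hb
  let V : (Fin m → ℤˣ) → (Fin m → Z) → ℝ := fun s =>
    weightedSup g fun i => ((s i : ℤ) : ℝ) * (1 / m)
  have hVm : ∀ s, AEMeasurable (V s) P := fun s => hg.aemeasurable_weightedSup _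
  have hVi : ∀ s, Integrable (V s) P := fun s =>
    integrable_of_abs_le (hVm s) (abs_sign_weightedSup_le hm hg0 hgM s)
  have hrad : ∫ S, rademacher g S ∂P = 𝔼 s, ∫ S, V s S ∂P := by
    simp only [rademacher, Fintype.expect_eq_sum_div_card]
    rw [integral_div, integral_finsetSum _ fun s _ => hVi s]
  have hdouble : ∫ S, ghostDeviation D M g S ∂P
      = ∫ W, weightedSup g b W ∂(Measure.pi fun _ => D) := by
    rw [integral_congr_ae (ghostDeviation_ae_eq hg hg0 hgM hm),
      ← MeasurePreserving.integral_comp_ae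
        ((measurePreserving_elim (D := D)).comp Measure.measurePreserving_swap)
        (hg.aemeasurable_weightedSup b),
      integral_prod]
    · rfl
    · exact integrable_of_abs_le (hg.aemeasurable_double b)
        fun p => abs_double_weightedSup_le hm hg0 hgM _
  -- The law of the double sample is invariant under the exchange, and the supremum over it splits
  -- into one for each half. Averaging over `s` then yields the factor 2.
  have hswap : ∀ s : Fin m → ℤˣ, ∫ W, weightedSup g b W ∂(Measure.pi fun _ => D)
      ≤ ∫ S, V s S ∂P + ∫ S, V (-s) S ∂P := by
    intro s
    set a : Fin m ⊕ Fin m → ℝ := b ∘ (signSwap s).symm with ha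
    have ha' : a = Sum.elim (fun i => ((s i : ℤ) : ℝ) * (1 / (m : ℝ)))
        (fun i => ((((-s) i : ℤˣ) : ℤ) : ℝ) * (1 / (m : ℝ))) := elim_comp_signSwap s _
    have ham := hg.aemeasurable_weightedSup (D := D) a
    have h1 : ∫ W, weightedSup g b W ∂(Measure.pi fun _ => D)
        = ∫ W, weightedSup g a W ∂(Measure.pi fun _ => D) := by
      rw [← MeasurePreserving.integral_comp_ae (measurePreserving_comp_equiv (D := D) (signSwap s))
        (hg.aemeasurable_weightedSup b)]
      simp only [weightedSup_comp_equiv, ha]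
    have hint : Integrable (fun p : (Fin m → Z) × (Fin m → Z) =>
        weightedSup g a (Sum.elim p.1 p.2)) (P.prod P) :=
      integrable_of_abs_le (ham.comp_quasiMeasurePreserving
        measurePreserving_elim.quasiMeasurePreserving) fun p => abs_weightedSup_le hg0 hgM a _
    have hfst : Integrable (fun p : (Fin m → Z) × (Fin m → Z) => V s p.1) (P.prod P) :=
      (hVi s).comp_fst P
    have hsnd : Integrable (fun p : (Fin m → Z) × (Fin m → Z) => V (-s) p.2) (P.prod P) :=
      (hVi (-s)).comp_snd P
    rw [h1, ← MeasurePreserving.integral_comp_ae (measurePreserving_elim (D := D)) ham]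
    calc ∫ p : (Fin m → Z) × (Fin m → Z), weightedSup g a (Sum.elim p.1 p.2) ∂(P.prod P)
        ≤ ∫ p : (Fin m → Z) × (Fin m → Z), (V s p.1 + V (-s) p.2) ∂(P.prod P) := by
          refine integral_mono hint (hfst.add hsnd) fun p => ?_
          rw [ha']
          exact weightedSup_elim_le hg0 hgM _ _ _ _
      _ = ∫ S, V s S ∂P + ∫ S, V (-s) S ∂P := by
          rw [integral_add hfst hsnd, integral_fun_fst (μ := P) (ν := P) (V s),
            integral_fun_snd (μ := P) (ν := P) (V (-s))]
          simp
  have hneg : 𝔼 s, ∫ S, V (-s) S ∂P = 𝔼 s, ∫ S, V s S ∂P :=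
    Fintype.expect_equiv (Equiv.neg _) _ _ fun s => rfl
  rw [hrad, hdouble]
  have := le_expect (s := (univ : Finset (Fin m → ℤˣ))) univ_nonempty fun s _ => hswap s
  rw [expect_add_distrib, hneg] at this
  linarith

theorem integral_empMean {m : ℕ} (hm : 0 < m) {f : Z → ℝ} (hf : AEMeasurable f D)
    (hfi : Integrable f D) :
    ∫ S : Fin m → Z, empMean S f ∂(Measure.pi fun _ => D) = ∫ z, f z ∂D := by
  have hev : ∀ i : Fin m, MeasurePreserving (Function.eval i) (Measure.pi fun _ : Fin m => D) D :=
    fun i => measurePreserving_eval (fun _ => D) i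
  have hi : ∀ i : Fin m, Integrable (fun S : Fin m → Z => f (S i)) (Measure.pi fun _ => D) :=
    fun i => (hev i).integrable_comp_of_integrable hfi
  have h1 : ∀ i : Fin m, ∫ S : Fin m → Z, f (S i) ∂(Measure.pi fun _ => D) = ∫ z, f z ∂D :=
    fun i => MeasurePreserving.integral_comp_ae (hev i) hf
  unfold empMean
  rw [integral_div, integral_finsetSum _ fun i _ => hi i]
  simp only [h1, sum_const, card_univ, Fintype.card_fin, nsmul_eq_mul]
  field_simp

/-- The expectation is the mean of the average over a fresh sample, and the lower mean is monotone.
Hence the bound holds for every `S`. -/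
theorem integral_sub_empMean_le [Nonempty ι] (hg : IsMeasurableClass D g)
    (hg0 : ∀ j z, 0 ≤ g j z) (hgM : ∀ j z, g j z ≤ M) {m : ℕ} (hm : 0 < m) (j : ι)
    (S : Fin m → Z) : ∫ z, g j z ∂D - empMean S (g j) ≤ ghostDeviation D M g S := by
  have hgi : Integrable (g j) D := integrable_of_abs_le (K := M) (hg.1 j) fun z => by
    rw [abs_of_nonneg (hg0 j z)]; exact hgM j z
  have hmeas : AEMeasurable (fun S' : Fin m → Z => empMean S' (g j)) (Measure.pi fun _ => D) := by
    unfold empMean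
    exact (Finset.aemeasurable_fun_sum _ fun i _ => (hg.1 j).comp_quasiMeasurePreserving
      (measurePreserving_eval (fun _ => D) i).quasiMeasurePreserving).div_const _
  have hsum : ∀ S' : Fin m → Z, empMean S' (g j) - empMean S (g j)
      = ∑ i, (Sum.elim (fun _ => 1 / (m : ℝ)) (fun _ => -(1 / (m : ℝ))) : Fin m ⊕ Fin m → ℝ) i
        * g j ((Sum.elim S' S : Fin m ⊕ Fin m → Z) i) := by
    intro S'
    simp only [Fintype.sum_sum_type, Sum.elim_inl, Sum.elim_inr, ← mul_sum, empMean]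
    ring
  have hbound : ∀ S' : Fin m → Z, |empMean S' (g j) - empMean S (g j)| ≤ 2 * M := by
    intro S'
    rw [hsum]
    refine (abs_weighted_sum_le hg0 hgM _ _ j).trans_eq ?_
    rw [Fintype.sum_sum_type]
    simp only [Sum.elim_inl, Sum.elim_inr, abs_neg]
    rw [sum_abs_inv_card hm]
    ring
  have hint : Integrable (fun S' : Fin m → Z => empMean S' (g j)) (Measure.pi fun _ => D) := by
    have h := integrable_of_abs_le (hmeas.sub_const (empMean S (g j))) hbound
    refine (h.add (integrable_const (empMean S (g j)))).congr (Filter.Eventually.of_forall ?_)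
    exact fun S' => sub_add_cancel _ _
  have h1 : lowerMean (Measure.pi fun _ : Fin m => D) (2 * M)
      (fun S' => empMean S' (g j) - empMean S (g j)) = ∫ z, g j z ∂D - empMean S (g j) := by
    rw [lowerMean_eq_integral (hmeas.sub_const _) hbound,
      integral_sub hint (integrable_const _), integral_empMean hm (hg.1 j) hgi]
    simp
  rw [← h1, ← add_zero (ghostDeviation D M g S)]
  refine lowerMean_le_add (fun _ => abs_double_weightedSup_le hm hg0 hgM _) le_rfl fun S' => ?_
  rw [hsum, add_zero]
  exact le_ciSup (bddAbove_weighted_sum hg0 hgM _ (Sum.elim S' S)) j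

theorem ghostDeviation_le_update [Nonempty ι] (hg0 : ∀ j z, 0 ≤ g j z) (hgM : ∀ j z, g j z ≤ M)
    (hM : 0 ≤ M) {m : ℕ} (hm : 0 < m) (S : Fin m → Z) (k : Fin m) (w : Z) :
    ghostDeviation D M g S ≤ ghostDeviation D M g (Function.update S k w) + M / m := by
  refine lowerMean_le_add (fun _ => abs_double_weightedSup_le hm hg0 hgM _) (by positivity)
    fun S' => ?_
  have h := weightedSup_le_update hg0 hgM
    (Sum.elim (fun _ => 1 / (m : ℝ)) (fun _ => -(1 / (m : ℝ))) : Fin m ⊕ Fin m → ℝ)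
    (Sum.elim S' S) (Sum.inr k) w
  rw [Sum.update_elim_inr] at h
  refine h.trans_eq ?_
  rw [Sum.elim_inr, abs_neg, abs_of_nonneg (by positivity)]
  ring

theorem rademacher_le_update {Z : Type*} {g : ι → Z → ℝ} [Nonempty ι] (hg0 : ∀ j z, 0 ≤ g j z) (hgM : ∀ j z, g j z ≤ M)
    {m : ℕ} (S : Fin m → Z) (k : Fin m) (w : Z) :
    rademacher g S ≤ rademacher g (Function.update S k w) + M / m := by
  unfold rademacher
  rw [← Fintype.expect_const (ι := Fin m → ℤˣ) (M / m), ← expect_add_distrib]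
  refine expect_le_expect fun s _ => (weightedSup_le_update hg0 hgM _ S k w).trans_eq ?_
  rw [abs_sign_mul, abs_of_nonneg (by positivity)]
  ring

theorem rademacher_zero {Z : Type*} {g : ι → Z → ℝ} {m : ℕ} (hg : ∀ j z, g j z = 0) (S : Fin m → Z) : rademacher g S = 0 := by
  simp [rademacher, weightedSup, hg]

/-- The uniform deviation bound by the empirical Rademacher complexity. -/
theorem measure_not_forall_integral_le [Nonempty ι] (hg : IsMeasurableClass D g)
    (hg0 : ∀ j z, 0 ≤ g j z) (hgM : ∀ j z, g j z ≤ M) {m : ℕ} (hm : 0 < m) {δ : ℝ} (hδ : 0 < δ) :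
    Measure.pi (fun _ : Fin m => D) {S | ¬ ∀ j, ∫ z, g j z ∂D
        ≤ empMean S (g j) + 2 * rademacher g S + 3 * M * √(Real.log (1 / δ) / (2 * m))}
      ≤ ENNReal.ofReal δ := by
  rcases le_or_gt 1 δ with h1 | h1
  · exact prob_le_one.trans (by simpa using ENNReal.ofReal_le_ofReal h1)
  have : Nonempty Z := D.nonempty_of_neZero
  have hM : 0 ≤ M := (hg0 (Classical.arbitrary _) (Classical.arbitrary _)).trans (hgM _ _)
  -- For `M = 0` McDiarmid's exponent has denominator zero, so this case is separate.
  rcases hM.eq_or_lt with hM0 | hM0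
  · have hz : ∀ j z, g j z = 0 := fun j z => le_antisymm (by rw [hM0]; exact hgM j z) (hg0 j z)
    simp [rademacher_zero hz, hz, empMean, ← hM0]
  set P : Measure (Fin m → Z) := Measure.pi fun _ => D
  set r := 3 * M * √(Real.log (1 / δ) / (2 * m)) with hr
  have hmpos : (0 : ℝ) < m := by exact_mod_cast hm
  let f : (Fin m → Z) → ℝ := fun S => ghostDeviation D M g S - 2 * rademacher g S
  have hgdm := aemeasurable_ghostDeviation hg hg0 hgM hm
  have hradm : AEMeasurable (rademacher g) P := hg.aemeasurable_rademacher
  have hfm : AEMeasurable f P := hgdm.sub (hradm.const_mul 2)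
  have hgdK : ∀ S : Fin m → Z, |ghostDeviation D M g S| ≤ 2 * M := fun S =>
    abs_lowerMean_le (by linarith) fun S' => abs_double_weightedSup_le hm hg0 hgM _
  have hfK : ∀ S, |f S| ≤ 4 * M := by
    intro S
    have h2 := abs_le.1 (hgdK S)
    have h3 := abs_le.1 (abs_rademacher_le hm hg0 hgM S)
    refine abs_le.2 ⟨?_, ?_⟩ <;> simp only [f] <;> linarith
  have hfc : ∀ S i z, f S ≤ f (Function.update S i z) + 3 * M / m := by
    intro S i z
    have h2 := ghostDeviation_le_update (D := D) hg0 hgM hM hm S i z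
    have h3 := rademacher_le_update hg0 hgM (Function.update S i z) i (S i)
    rw [Function.update_idem, Function.update_eq_self] at h3
    simp only [f]
    have : 3 * M / m = M / m + 2 * (M / m) := by ring
    linarith
  have hmean : ∫ S, f S ∂P ≤ 0 := by
    have h2 : Integrable (rademacher g) P :=
      integrable_of_abs_le hradm (abs_rademacher_le hm hg0 hgM)
    have h3 : Integrable (ghostDeviation D M g : (Fin m → Z) → ℝ) P :=
      integrable_of_abs_le hgdm hgdK
    have h4 := integral_ghostDeviation_le hg hg0 hgM hm
    simp only [f]
    rw [integral_sub h3 (h2.const_mul 2), integral_const_mul]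
    linarith
  have hmc := measure_ge_le_of_bounded_differences hfm (by positivity) hfK hfc
    (r := r) (by positivity)
  have hlog : 0 ≤ Real.log (1 / δ) := Real.log_nonneg (by rw [le_div_iff₀ hδ]; linarith)
  -- The threshold `r` is chosen so that McDiarmid's bound with differences `3M/m` equals `δ`.
  have hexp : -r ^ 2 / (2 * (m * (3 * M / m / 2) ^ 2)) = Real.log δ := by
    rw [hr, mul_pow, Real.sq_sqrt (by positivity), one_div, Real.log_inv]
    field_simp
  rw [hexp, Real.exp_log hδ] at hmc
  refine (measure_mono ?_).trans (ENNReal.le_ofReal_iff_toReal_le (measure_ne_top _ _) hδ.le |>.2 hmc)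
  intro S hS
  simp only [Set.mem_ofPred_eq, not_forall, not_le] at hS ⊢
  obtain ⟨j, hj⟩ := hS
  have := integral_sub_empMean_le hg hg0 hgM hm j S
  simp only [f] at hmean ⊢
  linarith

end StructPred

namespace StructPred

open scoped BigOperators
open Finset

/-! ### Contraction to the factor graph complexity -/

theorem coe_sum_ereal {α : Type*} (s : Finset α) (f : α → ℝ) :
    ((∑ a ∈ s, f a : ℝ) : EReal) = ∑ a ∈ s, (f a : EReal) := by
  induction s using Finset.cons_induction with
  | empty => simp
  | cons a s ha ih => rw [sum_cons, sum_cons, EReal.coe_add, ih]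

section FactorGraphComplexity

variable {X Y : Type*} {outputs : X → Set Y} {G : (z : X × Y) → FactorGraph (outputs z.1)}

/-- The Euclidean distance between the local scores of two scoring functions at an example, weighted
by the square root of the number of factors. -/
noncomputable def localDist (h h' : Scoring outputs G) (z : X × Y) : ℝ :=
  √(∑ p : (f : (G z).Factor) × (G z).LocalLabel f,
    (√(Fintype.card (G z).Factor : ℝ) * h.factor z p.1 p.2
      - √(Fintype.card (G z).Factor : ℝ) * h'.factor z p.1 p.2) ^ 2)

/-- Cauchy-Schwarz over the factors costs `|F|`, which is the square of the weight. For each factor,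
the square at the label `y'_f` is one term of the sum over all labels. -/
theorem abs_score_sub_le_localDist (h h' : Scoring outputs G) {x : X} {y : Y} (hy : y ∈ outputs x)
    {y' : Y} (hy' : y' ∈ outputs x) : |h.score x y' - h'.score x y'| ≤ localDist h h' (x, y) := by
  have e := h.decomp x y hy ⟨y', hy'⟩
  have e' := h'.decomp x y hy ⟨y', hy'⟩
  simp only at e e'
  rw [e, e', ← sum_sub_distrib]
  refine Real.abs_le_sqrt (sq_sum_le_card_mul_sum_sq.trans ?_)
  rw [Fintype.sum_sigma, mul_sum, card_univ]
  refine sum_le_sum fun f _ => ?_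
  simp only [← mul_sub, mul_pow, Real.sq_sqrt (Nat.cast_nonneg _)]
  rw [← mul_sum]
  refine mul_le_mul_of_nonneg_left ?_ (Nat.cast_nonneg _)
  exact single_le_sum
    (f := fun l => (h.factor (x, y) f l - h'.factor (x, y) f l) ^ 2)
    (fun _ _ => sq_nonneg _) (mem_univ _)

/-- The signed sum of weighted local scores in the factor graph complexity. -/
noncomputable def signedScore {m : ℕ} (S : Fin m → X × Y) (h : Scoring outputs G)
    (ε : SignIndex G S → ℤˣ) : ℝ :=
  ∑ i : Fin m, ∑ f : (G (S i)).Factor, ∑ y : (G (S i)).LocalLabel f,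
    √(Fintype.card (G (S i)).Factor : ℝ) * ((ε ⟨i, f, y⟩ : ℤ) : ℝ) * h.factor (S i) f y

open Classical in
-- On a finite subfamily the suprema are attained, so real suprema can be compared with the possibly
-- infinite ones.
theorem le_empComplexity_of_finite {H : Set (Scoring outputs G)} {m : ℕ} (S : Fin m → X × Y)
    {ι : Type*} [Finite ι] [Nonempty ι] (u : ι → Scoring outputs G) (hu : ∀ j, u j ∈ H) :
    ((1 / (m : ℝ) * 𝔼 ε : SignIndex G S → ℤˣ, ⨆ j, signedScore S (u j) ε : ℝ) : EReal)
      ≤ empComplexity H S := by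
  rw [EReal.coe_mul]
  unfold empComplexity
  refine mul_le_mul_of_nonneg_left ?_ (EReal.coe_nonneg.2 (by positivity))
  rw [Fintype.expect_eq_sum_div_card, div_eq_inv_mul, ← one_div, EReal.coe_mul]
  refine mul_le_mul_of_nonneg_left ?_ (EReal.coe_nonneg.2 (by positivity))
  rw [coe_sum_ereal]
  refine sum_le_sum fun ε _ => ?_
  obtain ⟨j, hj⟩ := exists_eq_ciSup_of_finite (f := fun j => signedScore S (u j) ε)
  rw [← hj]
  exact le_iSup₂_of_le (u j) (hu j) le_rfl

open Classical in
-- Contraction is available for finite classes. There are only finitely many sign vectors, so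
-- near-maximizers, one for each, form a finite subclass that loses at most `η`.
theorem rademacher_le_empComplexity {H : Set (Scoring outputs G)} [Nonempty H] {C : ℝ}
    (hC : 0 ≤ C) {g : H → X × Y → ℝ} {m : ℕ} (S : Fin m → X × Y)
    (hlip : ∀ i (h h' : H), |g h (S i) - g h' (S i)| ≤ C * localDist h.1 h'.1 (S i)) :
    (rademacher g S : EReal) ≤ ((√2 * C : ℝ) : EReal) * empComplexity H S := by
  refine EReal.ge_of_forall_gt_iff_ge.1 fun a ha => ?_
  have ha' : a < rademacher g S := by exact_mod_cast ha
  set η := rademacher g S - a with hη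
  have hsel : ∀ s : Fin m → ℤˣ, ∃ h : H, weightedSup g (fun i => ((s i : ℤ) : ℝ) * (1 / m)) S
      ≤ ∑ i, ((s i : ℤ) : ℝ) * (1 / m) * g h (S i) + η := by
    intro s
    obtain ⟨h, hh⟩ := exists_lt_of_lt_ciSup
      (f := fun h : H => ∑ i, ((s i : ℤ) : ℝ) * (1 / m) * g h (S i))
      (b := weightedSup g (fun i => ((s i : ℤ) : ℝ) * (1 / m)) S - η)
      (sub_lt_self _ (by linarith))
    exact ⟨h, by linarith⟩
  choose sel hsel using hsel
  let K : Fin m → Type _ := fun i => (f : (G (S i)).Factor) × (G (S i)).LocalLabel f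
  have hcontr := vector_contraction (ι := Set.range sel) K (fun _ => 0)
    (fun h i => 1 / m * g h.1 (S i))
    (fun h i k => 1 / m * C * (√(Fintype.card (G (S i)).Factor : ℝ) * h.1.1.factor (S i) k.1 k.2))
    (by
      intro i h h'
      have hCm : 0 ≤ 1 / (m : ℝ) * C := by positivity
      simp only [← mul_sub, mul_pow _ _ 2]
      rw [← mul_sum, Real.sqrt_mul (by positivity), ← mul_pow, Real.sqrt_sq hCm, abs_mul,
        abs_of_nonneg (by positivity : (0 : ℝ) ≤ 1 / m), mul_assoc]
      refine mul_le_mul_of_nonneg_left ((hlip i h.1 h'.1).trans_eq ?_) (by positivity)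
      simp only [localDist, ← mul_sub, mul_pow]
      rfl)
  have hleft : a ≤ 𝔼 s : Fin m → ℤˣ, ⨆ h : Set.range sel,
      ((0 : ℝ) + ∑ i, ((s i : ℤ) : ℝ) * (1 / m * g h.1 (S i))) := by
    have h1 : rademacher g S ≤ 𝔼 s : Fin m → ℤˣ, ((⨆ h : Set.range sel,
        ((0 : ℝ) + ∑ i, ((s i : ℤ) : ℝ) * (1 / m * g h.1 (S i)))) + η) := by
      refine expect_le_expect fun s _ => (hsel s).trans (add_le_add_left ?_ _)
      refine le_ciSup_of_le (Set.finite_range _).bddAbove ⟨sel s, s, rfl⟩ ?_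
      simp only [zero_add, mul_assoc, le_refl]
    rw [expect_add_distrib, Fintype.expect_const] at h1
    linarith
  have hright : 𝔼 x : (i : Fin m) → K i → ℤˣ, ⨆ h : Set.range sel,
      ((0 : ℝ) + √2 * ∑ i, ∑ k, ((x i k : ℤ) : ℝ) * (1 / m * C *
        (√(Fintype.card (G (S i)).Factor : ℝ) * h.1.1.factor (S i) k.1 k.2)))
      = √2 * C * (1 / (m : ℝ) * 𝔼 ε : SignIndex G S → ℤˣ,
          ⨆ h : Set.range sel, signedScore S h.1.1 ε) := by
    rw [← mul_assoc, mul_expect]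
    -- Families of sign vectors, one per example, are the curried form of sign vectors on
    -- `SignIndex`.
    refine (Fintype.expect_equiv (Equiv.piCurry fun (i : Fin m) (_ : K i) => ℤˣ) _ _
      fun ε => ?_).symm
    rw [Real.mul_iSup_of_nonneg (by positivity)]
    refine iSup_congr fun h => ?_
    rw [zero_add, signedScore, mul_assoc, mul_assoc]
    congr 1
    rw [mul_sum, mul_sum]
    refine sum_congr rfl fun i _ => ?_
    rw [Fintype.sum_sigma, mul_sum, mul_sum]
    refine sum_congr rfl fun f _ => ?_
    rw [mul_sum, mul_sum]
    refine sum_congr rfl fun y _ => ?_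
    simp only [Equiv.piCurry_apply, Sigma.curry]
    ring
  have hreal := hleft.trans (hcontr.trans_eq hright)
  calc (a : EReal) ≤ ((√2 * C * (1 / (m : ℝ) * 𝔼 ε : SignIndex G S → ℤˣ,
          ⨆ h : Set.range sel, signedScore S h.1.1 ε) : ℝ) : EReal) := EReal.coe_le_coe_iff.2 hreal
    _ ≤ ((√2 * C : ℝ) : EReal) * empComplexity H S := by
        rw [EReal.coe_mul]
        exact mul_le_mul_of_nonneg_left
          (le_empComplexity_of_finite S (fun h : Set.range sel => h.1.1) fun h => h.1.2)
          (EReal.coe_nonneg.2 (by positivity))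

end FactorGraphComplexity

end StructPred

namespace StructPred

/-! ### Margin losses -/

theorem abs_clip_sub_le (M a b : ℝ) : |clip M a - clip M b| ≤ |a - b| :=
  (abs_min_sub_min_le_max _ _ _ _).trans (by
    rw [sub_self, abs_zero, max_eq_right (abs_nonneg _)]
    refine (abs_max_sub_max_le_max _ _ _ _).trans ?_
    rw [sub_self, abs_zero, max_eq_right (abs_nonneg _)])

theorem clip_nonneg {M : ℝ} (hM : 0 ≤ M) (a : ℝ) : 0 ≤ clip M a := le_min hM (le_max_left _ _)

theorem clip_le (M a : ℝ) : clip M a ≤ M := min_le_left _ _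

theorem le_clip {M a r : ℝ} (hM : r ≤ M) (ha : r ≤ a) : r ≤ clip M a :=
  le_min hM (ha.trans (le_max_right _ _))

theorem abs_iSup_sub_iSup_le {ι : Type*} {a b : ι → ℝ} (ha : BddAbove (Set.range a))
    (hb : BddAbove (Set.range b)) {C : ℝ} (hC : 0 ≤ C) (h : ∀ i, |a i - b i| ≤ C) :
    |(⨆ i, a i) - ⨆ i, b i| ≤ C := by
  rcases isEmpty_or_nonempty ι with hι | hι
  -- With no competing output both suprema have the default value 0.
  · simpa [Real.iSup_of_isEmpty] using hC
  refine abs_sub_le_iff.2 ⟨?_, ?_⟩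
  · rw [sub_le_iff_le_add']
    exact ciSup_le fun i => by linarith [le_ciSup hb i, (abs_le.1 (h i)).2]
  · rw [sub_le_iff_le_add']
    exact ciSup_le fun i => by linarith [le_ciSup ha i, (abs_le.1 (h i)).1]

section Loss

variable {X Y : Type*} {outputs : X → Set Y} {loss : Y → Y → ℝ} {ρ : ℝ}

theorem loss_le_lossBound (hbdd : BddAbove (Set.range fun p : Y × Y => loss p.1 p.2)) (y y' : Y) :
    loss y y' ≤ lossBound loss := le_ciSup hbdd (y, y')

theorem lossBound_nonneg (h0 : ∀ y y', 0 ≤ loss y y') : 0 ≤ lossBound loss :=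
  Real.iSup_nonneg fun _ => h0 _ _

/-- The predictor attains the maximal score, which bounds the supremum even over infinitely many
outputs. Without a bound the real supremum would default to 0. -/
theorem bddAbove_add_margin (hρ : 0 < ρ)
    (hbdd : BddAbove (Set.range fun p : Y × Y => loss p.1 p.2)) {h : X → Y → ℝ} {p : X → Y}
    (hp : IsArgmax outputs h p) (z : X × Y) :
    BddAbove (Set.range fun y' : {y' : Y // y' ∈ outputs z.1 ∧ y' ≠ z.2} =>
      (loss y'.1 z.2 - (1 / ρ) * (h z.1 z.2 - h z.1 y'.1))) := by
  refine ⟨lossBound loss - (1 / ρ) * (h z.1 z.2 - h z.1 (p z.1)), ?_⟩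
  rintro _ ⟨y', rfl⟩
  have h1 := (hp z.1).2 y'.1 y'.2.1
  have h2 : (1 / ρ) * (h z.1 z.2 - h z.1 (p z.1)) ≤ (1 / ρ) * (h z.1 z.2 - h z.1 y'.1) :=
    mul_le_mul_of_nonneg_left (by linarith) (by positivity)
  have h3 := loss_le_lossBound hbdd y'.1 z.2
  simp only
  linarith

theorem bddAbove_mult_margin (hρ : 0 < ρ) (h0 : ∀ y y', 0 ≤ loss y y')
    (hbdd : BddAbove (Set.range fun p : Y × Y => loss p.1 p.2)) {h : X → Y → ℝ} {p : X → Y}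
    (hp : IsArgmax outputs h p) (z : X × Y) :
    BddAbove (Set.range fun y' : {y' : Y // y' ∈ outputs z.1 ∧ y' ≠ z.2} =>
      (loss y'.1 z.2 * (1 - (1 / ρ) * (h z.1 z.2 - h z.1 y'.1)))) := by
  -- The output `z.2` need not be available here and may outscore the prediction, so the bracket can
  -- be negative.
  refine ⟨lossBound loss * |1 - (1 / ρ) * (h z.1 z.2 - h z.1 (p z.1))|, ?_⟩
  rintro _ ⟨y', rfl⟩
  have h1 := (hp z.1).2 y'.1 y'.2.1
  have h2 : (1 / ρ) * (h z.1 z.2 - h z.1 (p z.1)) ≤ (1 / ρ) * (h z.1 z.2 - h z.1 y'.1) :=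
    mul_le_mul_of_nonneg_left (by linarith) (by positivity)
  refine (mul_le_mul_of_nonneg_left ?_ (h0 _ _)).trans
    (mul_le_mul_of_nonneg_right (loss_le_lossBound hbdd y'.1 z.2) (abs_nonneg _))
  exact le_trans (by linarith) (le_abs_self _)

/-- At `y' = p x` the score difference is nonpositive, so this term of the supremum is at least the
loss. A correct prediction has loss 0. -/
theorem loss_le_addLoss (hρ : 0 < ρ) (h0 : ∀ y y', 0 ≤ loss y y') (hdef : ∀ y, loss y y = 0)
    (hbdd : BddAbove (Set.range fun p : Y × Y => loss p.1 p.2)) {h : X → Y → ℝ} {p : X → Y}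
    (hp : IsArgmax outputs h p) {z : X × Y} (hz : z.2 ∈ outputs z.1) :
    loss (p z.1) z.2 ≤ addLoss outputs loss ρ h z := by
  by_cases hy : p z.1 = z.2
  · rw [hy, hdef]
    exact clip_nonneg (lossBound_nonneg h0) _
  refine le_clip (loss_le_lossBound hbdd _ _)
    (le_ciSup_of_le (bddAbove_add_margin hρ hbdd hp z) ⟨p z.1, (hp z.1).1, hy⟩ ?_)
  have h1 := mul_nonneg (by positivity : 0 ≤ 1 / ρ) (sub_nonneg.2 ((hp z.1).2 z.2 hz))
  linarith

theorem loss_le_multLoss (hρ : 0 < ρ) (h0 : ∀ y y', 0 ≤ loss y y') (hdef : ∀ y, loss y y = 0)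
    (hbdd : BddAbove (Set.range fun p : Y × Y => loss p.1 p.2)) {h : X → Y → ℝ} {p : X → Y}
    (hp : IsArgmax outputs h p) {z : X × Y} (hz : z.2 ∈ outputs z.1) :
    loss (p z.1) z.2 ≤ multLoss outputs loss ρ h z := by
  by_cases hy : p z.1 = z.2
  · rw [hy, hdef]
    exact clip_nonneg (lossBound_nonneg h0) _
  refine le_clip (loss_le_lossBound hbdd _ _)
    (le_ciSup_of_le (bddAbove_mult_margin hρ h0 hbdd hp z) ⟨p z.1, (hp z.1).1, hy⟩ ?_)
  have h1 := mul_nonneg (by positivity : 0 ≤ 1 / ρ) (sub_nonneg.2 ((hp z.1).2 z.2 hz))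
  exact le_mul_of_one_le_right (h0 _ _) (by linarith)

/-- The scaled score differences of two scoring functions are close when the scores are. -/
theorem abs_margin_sub_le (hρ : 0 < ρ) {h h' : X → Y → ℝ} {z : X × Y} (hz : z.2 ∈ outputs z.1)
    {B : ℝ} (hB : ∀ y ∈ outputs z.1, |h z.1 y - h' z.1 y| ≤ B) {y : Y} (hy : y ∈ outputs z.1) :
    |(1 / ρ) * (h z.1 z.2 - h z.1 y) - (1 / ρ) * (h' z.1 z.2 - h' z.1 y)| ≤ 2 / ρ * B := by
  rw [← mul_sub, abs_mul, abs_of_nonneg (by positivity : 0 ≤ 1 / ρ),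
    show 2 / ρ * B = 1 / ρ * (B + B) by ring]
  refine mul_le_mul_of_nonneg_left ?_ (by positivity)
  rw [sub_sub_sub_comm]
  exact (abs_sub _ _).trans (add_le_add (hB _ hz) (hB _ hy))

/-- Clipping and suprema are 1-Lipschitz, and each term contains two scores divided by `ρ`. -/
theorem abs_addLoss_sub_le (hρ : 0 < ρ)
    (hbdd : BddAbove (Set.range fun p : Y × Y => loss p.1 p.2)) {h h' : X → Y → ℝ} {p p' : X → Y}
    (hp : IsArgmax outputs h p) (hp' : IsArgmax outputs h' p') {z : X × Y}
    (hz : z.2 ∈ outputs z.1) {B : ℝ} (hB : ∀ y ∈ outputs z.1, |h z.1 y - h' z.1 y| ≤ B) :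
    |addLoss outputs loss ρ h z - addLoss outputs loss ρ h' z| ≤ 2 / ρ * B := by
  have hB0 : 0 ≤ B := (abs_nonneg _).trans (hB _ hz)
  refine (abs_clip_sub_le _ _ _).trans (abs_iSup_sub_iSup_le (bddAbove_add_margin hρ hbdd hp z)
    (bddAbove_add_margin hρ hbdd hp' z) (by positivity) fun y' => ?_)
  rw [sub_sub_sub_cancel_left, abs_sub_comm]
  exact abs_margin_sub_le hρ hz hB y'.2.1

theorem abs_multLoss_sub_le (hρ : 0 < ρ) (h0 : ∀ y y', 0 ≤ loss y y')
    (hbdd : BddAbove (Set.range fun p : Y × Y => loss p.1 p.2)) {h h' : X → Y → ℝ} {p p' : X → Y}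
    (hp : IsArgmax outputs h p) (hp' : IsArgmax outputs h' p') {z : X × Y}
    (hz : z.2 ∈ outputs z.1) {B : ℝ} (hB : ∀ y ∈ outputs z.1, |h z.1 y - h' z.1 y| ≤ B) :
    |multLoss outputs loss ρ h z - multLoss outputs loss ρ h' z|
      ≤ lossBound loss * (2 / ρ) * B := by
  have hB0 : 0 ≤ B := (abs_nonneg _).trans (hB _ hz)
  have hM := lossBound_nonneg h0
  refine (abs_clip_sub_le _ _ _).trans (abs_iSup_sub_iSup_le (bddAbove_mult_margin hρ h0 hbdd hp z)
    (bddAbove_mult_margin hρ h0 hbdd hp' z) (by positivity) fun y' => ?_)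
  rw [← mul_sub, sub_sub_sub_cancel_left, abs_mul, abs_of_nonneg (h0 _ _), abs_sub_comm, mul_assoc]
  exact mul_le_mul (loss_le_lossBound hbdd _ _) (abs_margin_sub_le hρ hz hB y'.2.1)
    (abs_nonneg _) hM

end Loss

/-- The margin bound for any surrogate `L` of a bounded loss that is Lipschitz in the scores. -/
theorem margin_bound {X Y : Type*} [MeasurableSpace X] [MeasurableSpace Y]
    {D : Measure (X × Y)} [IsProbabilityMeasure D] {outputs : X → Set Y}
    (houtputs : ∀ᵐ z ∂D, z.2 ∈ outputs z.1) {G : (z : X × Y) → FactorGraph (outputs z.1)}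
    {H : Set (Scoring outputs G)} {M C : ℝ} (hC : 0 ≤ C) {R : Scoring outputs G → X × Y → ℝ}
    {L : (X → Y → ℝ) → X × Y → ℝ} (hR0 : ∀ h z, 0 ≤ R h z) (hRM : ∀ h z, R h z ≤ M)
    (hR : ∀ h ∈ H, AEMeasurable (R h) D) (hL0 : ∀ h z, 0 ≤ L h z) (hLM : ∀ h z, L h z ≤ M)
    (hL : IsMeasurableClass D fun h : H => L h.1.score)
    (hRL : ∀ h ∈ H, ∀ z : X × Y, z.2 ∈ outputs z.1 → R h z ≤ L h.score z)
    (hlip : ∀ h ∈ H, ∀ h' ∈ H, ∀ (z : X × Y) (B : ℝ), z.2 ∈ outputs z.1 →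
      (∀ y ∈ outputs z.1, |h.score z.1 y - h'.score z.1 y| ≤ B) →
      |L h.score z - L h'.score z| ≤ C * B)
    {m : ℕ} (hm : 0 < m) {δ : ℝ} (hδ : 0 < δ) :
    Measure.pi (fun _ : Fin m => D)
        {S | ¬ ∀ h ∈ H, ∫ z, R h z ∂D ≤ ∫ z, L h.score z ∂D ∧
          ((∫ z, L h.score z ∂D : ℝ) : EReal) ≤ (empMean S (L h.score) : EReal)
              + ((2 * (√2 * C) : ℝ) : EReal) * empComplexity H S
              + ((3 * M * √(Real.log (1 / δ) / (2 * m)) : ℝ) : EReal)}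
      ≤ ENNReal.ofReal δ := by
  rcases H.eq_empty_or_nonempty with rfl | hH
  · simp
  have : Nonempty H := hH.to_subtype
  refine (measure_mono_ae ?_).trans (measure_not_forall_integral_le hL (fun h => hL0 h.1.score)
    (fun h => hLM h.1.score) hm hδ)
  -- The Lipschitz estimate needs `y ∈ 𝒴(x)`, which almost surely holds at all sample points at
  -- once.
  have hS : ∀ᵐ S ∂(Measure.pi fun _ : Fin m => D), ∀ i, (S i).2 ∈ outputs (S i).1 :=
    ae_all_iff.2 fun i =>
      (measurePreserving_eval (fun _ : Fin m => D) i).quasiMeasurePreserving.ae houtputs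
  filter_upwards [hS] with S hS hmem
  refine fun hall => hmem fun h hh => ⟨?_, ?_⟩
  · refine integral_mono_ae
      (integrable_of_abs_le (K := M) (hR h hh) fun z => by
        rw [abs_of_nonneg (hR0 _ _)]; exact hRM _ _)
      (integrable_of_abs_le (K := M) (hL.1 ⟨h, hh⟩) fun z => by
        rw [abs_of_nonneg (hL0 _ _)]; exact hLM _ _) ?_
    filter_upwards [houtputs] with z hz using hRL h hh z hz
  · have hrad := rademacher_le_empComplexity (g := fun h : H => L h.1.score) hC S fun i h h' => hlip h.1 h.2 h'.1 h'.2 (S i) _ (hS i) fun y hy =>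
        abs_score_sub_le_localDist h.1 h'.1 (hS i) hy
    refine (EReal.coe_le_coe_iff.2 (hall ⟨h, hh⟩)).trans ?_
    rw [EReal.coe_add, EReal.coe_add, EReal.coe_mul 2, EReal.coe_mul 2,
      mul_assoc (2 : ℝ).toEReal]
    exact add_le_add_left (add_le_add_right (mul_le_mul_of_nonneg_left hrad
      (EReal.coe_nonneg.2 zero_le_two)) _) _

end StructPred

open MeasureTheory StructPred
theorem theorem4 {X Y : Type*} [MeasurableSpace X] [MeasurableSpace Y]
    -- the distribution of the examples
    (D : Measure (X × Y)) [IsProbabilityMeasure D]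
    -- the outputs available for each input, and the factor graph of each example
    (outputs : X → Set Y) (houtputs : ∀ᵐ z ∂D, z.2 ∈ outputs z.1)
    (G : (z : X × Y) → FactorGraph (outputs z.1))
    -- a bounded definite loss
    (loss : Y → Y → ℝ) (loss_nonneg : ∀ y y', 0 ≤ loss y y')
    (loss_definite : ∀ y y', loss y y' = 0 ↔ y = y')
    (loss_bdd : BddAbove (Set.range fun p : Y × Y => loss p.1 p.2))
    -- the hypothesis set and the predictors
    (H : Set (Scoring outputs G)) (pred : Scoring outputs G → X → Y)
    (hpred : ∀ h ∈ H, IsArgmax outputs h.score (pred h))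
    (ρ : ℝ) (hρ : 0 < ρ)
    -- measurability
    (hmeas : ∀ h ∈ H, AEMeasurable (fun z : X × Y => loss (pred h z.1) z.2) D)
    (hadd : IsMeasurableClass D fun h : H => addLoss outputs loss ρ h.1.score)
    (hmult : IsMeasurableClass D fun h : H => multLoss outputs loss ρ h.1.score)
    (m : ℕ) (hm : 0 < m) (δ : ℝ) (hδ : 0 < δ) :
    Measure.pi (fun _ : Fin m => D)
        {S | ¬ ∀ h ∈ H,
          ∫ z, loss (pred h z.1) z.2 ∂D ≤ ∫ z, addLoss outputs loss ρ h.score z ∂D ∧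
          ((∫ z, addLoss outputs loss ρ h.score z ∂D : ℝ) : EReal) ≤
            (empMean S (addLoss outputs loss ρ h.score) : EReal)
              + ((4 * √2 / ρ : ℝ) : EReal) * empComplexity H S
              + ((3 * lossBound loss * √(Real.log (1 / δ) / (2 * m)) : ℝ) : EReal)}
      ≤ ENNReal.ofReal δ ∧
    Measure.pi (fun _ : Fin m => D)
        {S | ¬ ∀ h ∈ H,
          ∫ z, loss (pred h z.1) z.2 ∂D ≤ ∫ z, multLoss outputs loss ρ h.score z ∂D ∧
          ((∫ z, multLoss outputs loss ρ h.score z ∂D : ℝ) : EReal) ≤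
            (empMean S (multLoss outputs loss ρ h.score) : EReal)
              + ((4 * √2 * lossBound loss / ρ : ℝ) : EReal) * empComplexity H S
              + ((3 * lossBound loss * √(Real.log (1 / δ) / (2 * m)) : ℝ) : EReal)}
      ≤ ENNReal.ofReal δ := by
  have hdef : ∀ y, loss y y = 0 := fun y => (loss_definite y y).2 rfl
  have hM := lossBound_nonneg loss_nonneg
  constructor
  · have h := margin_bound houtputs (R := fun h z => loss (pred h z.1) z.2)
      (L := addLoss outputs loss ρ) (C := 2 / ρ) (by positivity) (fun _ _ => loss_nonneg _ _)
      (fun _ _ => loss_le_lossBound loss_bdd _ _) hmeas (fun _ _ => clip_nonneg hM _)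
      (fun _ _ => clip_le _ _) hadd
      (fun h hh z hz => loss_le_addLoss hρ loss_nonneg hdef loss_bdd (hpred h hh) hz)
      (fun h hh h' hh' z B hz hB =>
        abs_addLoss_sub_le hρ loss_bdd (hpred h hh) (hpred h' hh') hz hB) hm hδ
    rwa [show 2 * (√2 * (2 / ρ)) = 4 * √2 / ρ by ring] at h
  · have h := margin_bound houtputs (R := fun h z => loss (pred h z.1) z.2)
      (L := multLoss outputs loss ρ) (C := lossBound loss * (2 / ρ)) (by positivity)
      (fun _ _ => loss_nonneg _ _)
      (fun _ _ => loss_le_lossBound loss_bdd _ _) hmeas (fun _ _ => clip_nonneg hM _)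
      (fun _ _ => clip_le _ _) hmult
      (fun h hh z hz => loss_le_multLoss hρ loss_nonneg hdef loss_bdd (hpred h hh) hz)
      (fun h hh h' hh' z B hz hB =>
        abs_multLoss_sub_le hρ loss_nonneg loss_bdd (hpred h hh) (hpred h' hh') hz hB) hm hδ
    rwa [show 2 * (√2 * (lossBound loss * (2 / ρ))) = 4 * √2 * lossBound loss / ρ by ring] at h
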